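/- Let \((V,\eta)\) be a finite-dimensional real vector space with a non-degenerate symmetric bilinear form, let \(S\) be a (possibly \(N\)-extended) real spinor module of \((V,\eta)\), i.e. a finite-dimensional real module of the even Clifford algebra \(\mathrm{Cl}_{\bar 0}(V,\eta)\), with the induced action of \(\mathfrak{so}(V)\), and let \(\kappa:\bigodot^2 S\to V\) be a symmetric \(\mathfrak{so}(V)\)-equivariant bilinear map. Let \(\mathfrak{s}=V\oplus S\oplus\mathfrak{so}(V)\) be the \(\mathbb{Z}\)-graded Lie superalgebra with \(\mathfrak{s}_{-2}=V\), \(\mathfrak{s}_{-1}=S\), \(\mathfrak{s}_0=\mathfrak{so}(V)\) (parity being the degree mod 2) and brackets \[ [A,B]=AB-BA,\quad [A,v]=Av,\quad [A,s]=A\cdot s,\quad [s,t]=\kappa(s,t),\quad [v,w]=0,\quad [v,s]=0 . \] Let \(\mathfrak{a}=V'\oplus S'\oplus\mathfrak{h}\) be a graded subalgebra of \(\mathfrak{s}\), and \(\mathfrak{a}_-=V'\oplus S'\). A filtered deformation of \(\mathfrak{a}\) is a Lie superalgebra \(\widetilde{\mathfrak a}\) with a finite decreasing filtration \(\widetilde{\mathfrak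 a}^\bullet\), \([\widetilde{\mathfrak a}^k,\widetilde{\mathfrak a}^l]\subseteq\widetilde{\mathfrak a}^{k+l}\), such that each \(\widetilde{\mathfrak a}^k\) is the sum of its even and odd parts, \(\widetilde{\mathfrak a}^{2k-1}_{\bar0}=\widetilde{\mathfrak a}^{2k}_{\bar0}\) and \(\widetilde{\mathfrak a}^{2k}_{\bar1}=\widetilde{\mathfrak a}^{2k+1}_{\bar1}\), together with an isomorphism \(\operatorname{Gr}\widetilde{\mathfrak a}\cong\mathfrak a\) of graded Lie superalgebras. Choosing complements \(W_k\) of \(\widetilde{\mathfrak a}^{k+1}\) in \(\widetilde{\mathfrak a}^{k}\) contained in the part of parity \(k\) identifies \(\widetilde{\mathfrak a}\) with \(\mathfrak a\) as a vector space, and its bracket with \([x,y]+\sum_{d>0}\mu_d(x,y)\), where \(\mu_d\) has degree \(d\); \((\mu_d)_{d>0}\) is called a defining sequence of \(\widetilde{\mathfrak a}\). Write \(\mu=\mu_2\). Let \(\mathsf C^{2,p}(\mathfrak a_-;\mathfrak a)=\operatorname{Hom}(\Lambda^p\mathfrak a_-,\mathfrak a)_2\) (\(\Lambda^p\) in the super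 sense) be the degree-2 Spencer complex, i.e. the degree-2 part of the Chevalley–Eilenberg complex of \(\mathfrak a_-\) with values in \(\mathfrak a\), and \(\mathsf H^{2,2}(\mathfrak a_-;\mathfrak a)\) its cohomology at \(p=2\), which is an \(\mathfrak h\)-module. Let \(\widetilde{\mathfrak a}\) be a filtered deformation of \(\mathfrak a\) with a defining sequence, and \(\mu\) its degree-2 term. Then: 1. \(\mu|_{\mathfrak a_-\otimes\mathfrak a_-}\) is a cocycle in \(\mathsf C^{2,2}(\mathfrak a_-;\mathfrak a)\) and its class lies in \(\mathsf H^{2,2}(\mathfrak a_-;\mathfrak a)^{\mathfrak h}\). Furthermore, \(\mu\) is a cocycle in the Chevalley–Eilenberg complex \(\mathsf C^2(\mathfrak a;\mathfrak a)\). 2. Suppose that \(\eta\) is Lorentzian, that \(\kappa\) is causal (\(\kappa(s,s)\) is timelike or null, the zero vector being allowed, for all \(s\in S\)), and that \(\widetilde{\mathfrak a}\) is highly supersymmetric, i.e. \(\dim\widetilde{\mathfrak a}_{\bar1}>\tfrac12\dim S\) (equivalently \(\dim S'>\tfrac12\dim S\)). If \(\widetilde{\mathfrak a}'\) is another filtered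 deformation of \(\mathfrak a\), with a defining sequence whose degree-2 term \(\mu'\) satisfies \([\mu'|_{\mathfrak a_-\otimes\mathfrak a_-}]=[\mu|_{\mathfrak a_-\otimes\mathfrak a_-}]\) in \(\mathsf H^{2,2}(\mathfrak a_-;\mathfrak a)\), then \(\widetilde{\mathfrak a}\cong\widetilde{\mathfrak a}'\) as filtered Lie superalgebras, by an even linear isomorphism that preserves the brackets and maps \(\widetilde{\mathfrak a}^k\) onto \(\widetilde{\mathfrak a}'^k\) for all \(k\). -/

import Mathlib

open scoped TensorProduct

namespace SpencerDef

/-- The Koszul sign `(-1)^{i j}` of two parities. -/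
def superSign (i j : ZMod 2) : ℝ := if i = 1 ∧ j = 1 then -1 else 1

/-! ### Lie superalgebras, graded and filtered -/

/-- A real Lie superalgebra structure on a real vector space `L`. -/
structure LieSuperalgebra (L : Type*) [AddCommGroup L] [Module ℝ L] where
  parity : ZMod 2 → Submodule ℝ L
  parity_isCompl : IsCompl (parity 0) (parity 1)
  bracket : L →ₗ[ℝ] L →ₗ[ℝ] L
  bracket_parity : ∀ (i j : ZMod 2) (x y : L), x ∈ parity i → y ∈ parity j →
    bracket x y ∈ parity (i + j)
  skew : ∀ (i j : ZMod 2) (x y : L), x ∈ parity i → y ∈ parity j →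
    bracket y x = -(superSign i j • bracket x y)
  jacobi : ∀ (i j : ZMod 2) (x y z : L), x ∈ parity i → y ∈ parity j →
    bracket x (bracket y z) =
      bracket (bracket x y) z + superSign i j • bracket y (bracket x z)

/-- A `ℤ`-graded Lie superalgebra; the `ℤ`-grading induces the parity grading. -/
structure GradedLieSuperalgebra (L : Type*) [AddCommGroup L] [Module ℝ L] extends
    LieSuperalgebra L where
  grade : ℤ → Submodule ℝ L
  grade_isInternal : DirectSum.IsInternal grade
  grade_le_parity : ∀ k : ℤ, grade k ≤ parity (k : ZMod 2)
  bracket_grade : ∀ (k l : ℤ) (x y : L), x ∈ grade k → y ∈ grade l →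
    bracket x y ∈ grade (k + l)

/-- A `ℤ`-filtered Lie superalgebra, with a (finite) decreasing filtration
compatible with the parity. -/
structure FilteredLieSuperalgebra (M : Type*) [AddCommGroup M] [Module ℝ M] extends
    LieSuperalgebra M where
  filt : ℤ → Submodule ℝ M
  filt_antitone : Antitone filt
  filt_eq_top : ∃ k, filt k = ⊤
  filt_eq_bot : ∃ k, filt k = ⊥
  filt_parity : ∀ k, filt k = (filt k ⊓ parity 0) ⊔ (filt k ⊓ parity 1)
  filt_even : ∀ k, filt (2 * k - 1) ⊓ parity 0 = filt (2 * k) ⊓ parity 0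
  filt_odd : ∀ k, filt (2 * k) ⊓ parity 1 = filt (2 * k + 1) ⊓ parity 1
  bracket_filt : ∀ (k l : ℤ) (x y : M), x ∈ filt k → y ∈ filt l →
    bracket x y ∈ filt (k + l)

section

variable {L : Type*} [AddCommGroup L] [Module ℝ L]
variable {M : Type*} [AddCommGroup M] [Module ℝ M]
variable {M' : Type*} [AddCommGroup M'] [Module ℝ M']

/-- An isomorphism of filtered Lie superalgebras: an even linear isomorphism which preserves the
brackets and is strictly filtered. -/
structure FilteredIso (F : FilteredLieSuperalgebra M) (F' : FilteredLieSuperalgebra M') where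
  toEquiv : M ≃ₗ[ℝ] M'
  map_bracket : ∀ x y, toEquiv (F.bracket x y) = F'.bracket (toEquiv x) (toEquiv y)
  map_parity : ∀ i, (F.parity i).map (toEquiv : M →ₗ[ℝ] M') = F'.parity i
  map_filt : ∀ k, (F.filt k).map (toEquiv : M →ₗ[ℝ] M') = F'.filt k

/-- The degree-`k` part `M^k / M^{k+1}` of the associated graded space. -/
abbrev FilteredLieSuperalgebra.Gr (F : FilteredLieSuperalgebra M) (k : ℤ) : Type _ :=
  F.filt k ⧸ (F.filt (k + 1)).submoduleOf (F.filt k)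

/-- The class in `M^k / M^{k+1}` of an element of `M^k`. -/
def FilteredLieSuperalgebra.toGr (F : FilteredLieSuperalgebra M) (k : ℤ) :
    F.filt k →ₗ[ℝ] F.Gr k :=
  ((F.filt (k + 1)).submoduleOf (F.filt k)).mkQ

/-- `F` is a filtered deformation of the graded Lie superalgebra `G`, by means of an isomorphism
`Gr F ≅ G` of graded Lie superalgebras (the bracket on `Gr F` being induced by that of `F`). -/
structure FilteredDeformation (G : GradedLieSuperalgebra L) (F : FilteredLieSuperalgebra M) where
  grIso : ∀ k, F.Gr k ≃ₗ[ℝ] G.grade k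
  grIso_bracket : ∀ (k l : ℤ) (x : F.filt k) (y : F.filt l),
    (grIso (k + l) (F.toGr (k + l)
        ⟨F.bracket x y, F.bracket_filt k l x y x.2 y.2⟩) : L) =
      G.bracket (grIso k (F.toGr k x)) (grIso l (F.toGr l y))

/-- A defining sequence `(μ_d)_{d > 0}` of a filtered deformation. The choice of complements
`W_k` of `M^{k+1}` in `M^k`, contained in the subspaces of parity `k`, is encoded by the linear
isomorphism `Φ : G ≅ F` with `W_k = Φ (G_k)` that it induces; transporting the bracket of `F`
along `Φ` gives the deformation `[x,y] + ∑_{d>0} μ_d(x,y)` of the bracket of `G`, where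
`μ_d` has degree `d` (the sum being finite). The value `μ 0` plays no role. -/
structure DefiningSequence {G : GradedLieSuperalgebra L} {F : FilteredLieSuperalgebra M}
    (D : FilteredDeformation G F) where
  Φ : L ≃ₗ[ℝ] M
  Φ_filt : ∀ (k : ℤ) (x : G.grade k), Φ x ∈ F.filt k
  Φ_parity : ∀ (k : ℤ) (x : G.grade k), Φ x ∈ F.parity (k : ZMod 2)
  Φ_gr : ∀ (k : ℤ) (x : G.grade k), D.grIso k (F.toGr k ⟨Φ x, Φ_filt k x⟩) = x
  μ : ℕ → L →ₗ[ℝ] L →ₗ[ℝ] L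
  μ_degree : ∀ (d : ℕ), 0 < d → ∀ (k l : ℤ) (x y : L), x ∈ G.grade k → y ∈ G.grade l →
    μ d x y ∈ G.grade (k + l + d)
  bracket_eq : ∀ x y, ∃ N : ℕ, ∀ n ≥ N,
    Φ.symm (F.bracket (Φ x) (Φ y)) = G.bracket x y + ∑ d ∈ Finset.Icc 1 n, μ d x y

/-! ### Graded subalgebras -/

/-- A graded subalgebra of a graded Lie superalgebra. -/
structure GradedSubalgebra (G : GradedLieSuperalgebra L) where
  carrier : Submodule ℝ L
  homogeneous : carrier = ⨆ k, carrier ⊓ G.grade k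
  bracket_mem : ∀ x y, x ∈ carrier → y ∈ carrier → G.bracket x y ∈ carrier

namespace GradedSubalgebra

variable {G : GradedLieSuperalgebra L}

/-- The bracket of a graded subalgebra. -/
def bracket (n : GradedSubalgebra G) : n.carrier →ₗ[ℝ] n.carrier →ₗ[ℝ] n.carrier :=
  LinearMap.mk₂ ℝ (fun x y => ⟨G.bracket x y, n.bracket_mem x y x.2 y.2⟩)
    (fun _ _ _ => Subtype.ext (by simp)) (fun _ _ _ => Subtype.ext (by simp))
    (fun _ _ _ => Subtype.ext (by simp)) (fun _ _ _ => Subtype.ext (by simp))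

@[simp]
theorem coe_bracket (n : GradedSubalgebra G) (x y : n.carrier) :
    (n.bracket x y : L) = G.bracket x y := rfl

theorem grade_iSup (n : GradedSubalgebra G) :
    ⨆ k, (G.grade k).submoduleOf n.carrier = ⊤ := by
  apply Submodule.map_injective_of_injective n.carrier.injective_subtype
  rw [Submodule.map_iSup, Submodule.map_top, Submodule.range_subtype]
  conv_rhs => rw [n.homogeneous]
  refine iSup_congr fun k => ?_
  rw [Submodule.submoduleOf, Submodule.map_comap_subtype]

theorem grade_iSupIndep (n : GradedSubalgebra G) :
    iSupIndep fun k => (G.grade k).submoduleOf n.carrier := by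
  have h := G.grade_isInternal.submodule_iSupIndep
  intro k
  rw [Submodule.disjoint_def]
  intro x hx hx'
  have h1 := (Submodule.disjoint_def.1 (h k)) (x : L) hx
  apply Subtype.ext
  apply h1
  have h2 : (x : L) ∈ (⨆ j, ⨆ (_ : j ≠ k), (G.grade j).submoduleOf n.carrier).map
      n.carrier.subtype := ⟨x, hx', rfl⟩
  simp only [Submodule.map_iSup] at h2
  refine (iSup₂_mono fun j _ => ?_ :
    (⨆ j, ⨆ (_ : j ≠ k), ((G.grade j).submoduleOf n.carrier).map n.carrier.subtype) ≤ _) h2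
  rw [Submodule.submoduleOf, Submodule.map_comap_subtype]
  exact inf_le_right

theorem parity_isCompl (n : GradedSubalgebra G) :
    IsCompl ((G.parity 0).submoduleOf n.carrier) ((G.parity 1).submoduleOf n.carrier) := by
  constructor
  · rw [Submodule.disjoint_def]
    intro x h0 h1
    exact Subtype.ext ((Submodule.disjoint_def.1 G.parity_isCompl.disjoint) (x : L) h0 h1)
  · rw [codisjoint_iff, eq_top_iff, ← n.grade_iSup]
    refine iSup_le fun k => ?_
    have hk := G.grade_le_parity k
    generalize (k : ZMod 2) = i at hk
    fin_cases i
    · exact le_sup_of_le_left (Submodule.comap_mono hk)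
    · exact le_sup_of_le_right (Submodule.comap_mono hk)

/-- A graded subalgebra as a graded Lie superalgebra. -/
def toGraded (n : GradedSubalgebra G) : GradedLieSuperalgebra n.carrier where
  parity i := (G.parity i).submoduleOf n.carrier
  parity_isCompl := n.parity_isCompl
  bracket := n.bracket
  bracket_parity i j x y hx hy := G.bracket_parity i j x y hx hy
  skew i j x y hx hy := Subtype.ext (by simpa using G.skew i j x y hx hy)
  jacobi i j x y z hx hy := Subtype.ext (by simpa using G.jacobi i j x y z hx hy)
  grade k := (G.grade k).submoduleOf n.carrier
  grade_isInternal := DirectSum.isInternal_submodule_of_iSupIndep_of_iSup_eq_top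
    n.grade_iSupIndep n.grade_iSup
  grade_le_parity k _ hx := G.grade_le_parity k hx
  bracket_grade k l x y hx hy := G.bracket_grade k l x y hx hy

end GradedSubalgebra

/-- The whole of `G` as a graded subalgebra. -/
def GradedLieSuperalgebra.full (G : GradedLieSuperalgebra L) : GradedSubalgebra G where
  carrier := ⊤
  homogeneous := by
    simp only [top_inf_eq]
    exact G.grade_isInternal.submodule_iSup_eq_top.symm
  bracket_mem _ _ _ _ := trivial

theorem GradedLieSuperalgebra.bracket_mem_neg (G : GradedLieSuperalgebra L) (k : ℤ) (hk : k ≤ 0)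
    (x y : L) (hx : x ∈ G.grade k) (hy : y ∈ ⨆ l : ℤ, ⨆ _ : l < 0, G.grade l) :
    G.bracket x y ∈ ⨆ l : ℤ, ⨆ _ : l < 0, G.grade l := by
  have h : (⨆ l : ℤ, ⨆ _ : l < 0, G.grade l) ≤
      (⨆ l : ℤ, ⨆ _ : l < 0, G.grade l).comap (G.bracket x) := by
    refine iSup₂_le fun l hl y hy => ?_
    exact Submodule.mem_iSup_of_mem (k + l)
      (Submodule.mem_iSup_of_mem (by omega) (G.bracket_grade k l x y hx hy))
  exact h hy

/-- The subalgebra `G_- = ⨁_{k<0} G_k`. -/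
def GradedLieSuperalgebra.neg (G : GradedLieSuperalgebra L) : GradedSubalgebra G where
  carrier := ⨆ k : ℤ, ⨆ _ : k < 0, G.grade k
  homogeneous := by
    apply le_antisymm
    · refine iSup₂_le fun k hk => le_iSup_of_le k (le_inf ?_ le_rfl)
      exact le_iSup₂_of_le k hk le_rfl
    · exact iSup_le fun k => inf_le_left
  bracket_mem x y hx hy := by
    have h : (⨆ l : ℤ, ⨆ _ : l < 0, G.grade l) ≤
        (⨆ l : ℤ, ⨆ _ : l < 0, G.grade l).comap (G.bracket.flip y) :=
      iSup₂_le fun k hk x hx => G.bracket_mem_neg k hk.le x y hx hy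
    exact h hx

/-! ### The degree-2 part of the Chevalley-Eilenberg complex of a graded subalgebra

For a graded subalgebra `n` of `G`, these are the parts of homological degree `1` and `2` of the
degree-`2` complex of `n` with values in `G`: the Spencer complex for `n = G.neg`, the
Chevalley-Eilenberg complex with values in the adjoint representation for `n = G.full`. -/

section Complex

variable {G : GradedLieSuperalgebra L}

/-- `C^{2,1}(n; G)`: linear maps `n → G` of degree `2`. -/
def C1 (n : GradedSubalgebra G) : Submodule ℝ (n.carrier →ₗ[ℝ] L) where
  carrier := {f | ∀ (k : ℤ) (x : n.carrier), (x : L) ∈ G.grade k → f x ∈ G.grade (k + 2)}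
  add_mem' hf hg k x hx := add_mem (hf k x hx) (hg k x hx)
  zero_mem' _ _ _ := zero_mem _
  smul_mem' c _ hf k x hx := Submodule.smul_mem _ c (hf k x hx)

/-- Bilinear maps `n × n → G`, as linear maps on the tensor square. -/
abbrev Bil (n : GradedSubalgebra G) : Type _ := n.carrier ⊗[ℝ] n.carrier →ₗ[ℝ] L

/-- `C^{2,2}(n; G)`: bilinear maps `n × n → G` of degree `2`, skew-symmetric in the super sense. -/
def C2 (n : GradedSubalgebra G) : Submodule ℝ (Bil n) where
  carrier := {φ | ∀ (k l : ℤ) (x y : n.carrier), (x : L) ∈ G.grade k → (y : L) ∈ G.grade l →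
    φ (x ⊗ₜ y) ∈ G.grade (k + l + 2) ∧ φ (y ⊗ₜ x) = -(superSign k l • φ (x ⊗ₜ y))}
  add_mem' hf hg k l x y hx hy := by
    refine ⟨add_mem (hf k l x y hx hy).1 (hg k l x y hx hy).1, ?_⟩
    simp only [LinearMap.add_apply, (hf k l x y hx hy).2, (hg k l x y hx hy).2]
    module
  zero_mem' _ _ _ _ _ _ := ⟨zero_mem _, by simp⟩
  smul_mem' c _ hf k l x y hx hy := by
    refine ⟨Submodule.smul_mem _ c (hf k l x y hx hy).1, ?_⟩
    simp only [LinearMap.smul_apply, (hf k l x y hx hy).2]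
    module

/-- The value `(∂f)(x, y)` of the differential of `f` in `C^{2,1}`, for `x, y` homogeneous of
degrees `k, l`. -/
def d1 (n : GradedSubalgebra G) (f : n.carrier →ₗ[ℝ] L) (k l : ℤ) (x y : n.carrier) : L :=
  G.bracket x (f y) - superSign k l • G.bracket y (f x) - f (n.bracket x y)

/-- The value `(∂φ)(x, y, z)` of the differential of `φ` in `C^{2,2}`, for `x, y, z` homogeneous
of degrees `k, l, m`. -/
def d2 (n : GradedSubalgebra G) (φ : Bil n) (k l m : ℤ) (x y z : n.carrier) : L :=
  (G.bracket x (φ (y ⊗ₜ z)) - φ (n.bracket x y ⊗ₜ z))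
    + superSign k (l + m) • (G.bracket y (φ (z ⊗ₜ x)) - φ (n.bracket y z ⊗ₜ x))
    + superSign (k + l) m • (G.bracket z (φ (x ⊗ₜ y)) - φ (n.bracket z x ⊗ₜ y))

/-- The cocycles `Z^{2,2}(n; G)`. -/
def Z2 (n : GradedSubalgebra G) : Submodule ℝ (Bil n) where
  carrier := {φ | φ ∈ C2 n ∧ ∀ (k l m : ℤ) (x y z : n.carrier), (x : L) ∈ G.grade k →
    (y : L) ∈ G.grade l → (z : L) ∈ G.grade m → d2 n φ k l m x y z = 0}
  add_mem' := by
    rintro φ ψ hf hg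
    refine ⟨add_mem hf.1 hg.1, fun k l m x y z hx hy hz => ?_⟩
    have h : d2 n (φ + ψ) k l m x y z = d2 n φ k l m x y z + d2 n ψ k l m x y z := by
      simp only [d2, LinearMap.add_apply, map_add]
      module
    rw [h, hf.2 k l m x y z hx hy hz, hg.2 k l m x y z hx hy hz, add_zero]
  zero_mem' := ⟨zero_mem _, fun k l m x y z _ _ _ => by simp [d2]⟩
  smul_mem' c φ hf := by
    refine ⟨Submodule.smul_mem _ c hf.1, fun k l m x y z hx hy hz => ?_⟩
    have h1 := hf.2 k l m x y z hx hy hz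
    rw [← smul_zero c, ← h1]
    simp only [d2, LinearMap.smul_apply, map_smul]
    module

/-- The coboundaries `B^{2,2}(n; G) = ∂ C^{2,1}(n; G)`. -/
def B2 (n : GradedSubalgebra G) : Submodule ℝ (Bil n) where
  carrier := {φ | φ ∈ C2 n ∧ ∃ f ∈ C1 n, ∀ (k l : ℤ) (x y : n.carrier), (x : L) ∈ G.grade k →
    (y : L) ∈ G.grade l → φ (x ⊗ₜ y) = d1 n f k l x y}
  add_mem' := by
    rintro φ ψ ⟨hφ, f, hf, h1⟩ ⟨hψ, g, hg, h2⟩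
    refine ⟨add_mem hφ hψ, f + g, add_mem hf hg, fun k l x y hx hy => ?_⟩
    simp only [LinearMap.add_apply, h1 k l x y hx hy, h2 k l x y hx hy, d1, map_add]
    module
  zero_mem' := ⟨zero_mem _, 0, zero_mem _, fun k l x y _ _ => by simp [d1]⟩
  smul_mem' := by
    rintro c φ ⟨hφ, f, hf, h1⟩
    refine ⟨Submodule.smul_mem _ c hφ, c • f, Submodule.smul_mem _ c hf,
      fun k l x y hx hy => ?_⟩
    simp only [LinearMap.smul_apply, h1 k l x y hx hy, d1, map_smul]
    module

end Complex

/-- The restriction to `n × n` of a bilinear map on `G`. -/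
def GradedSubalgebra.restrict {G : GradedLieSuperalgebra L} (n : GradedSubalgebra G)
    (μ : L →ₗ[ℝ] L →ₗ[ℝ] L) : Bil n :=
  TensorProduct.lift (μ.domRestrict₁₂ n.carrier n.carrier)

/-! ### The Spencer cohomology `H^{2,2}(G_-; G)` as a `G_0`-module -/

section Spencer

variable (G : GradedLieSuperalgebra L)

/-- The Spencer cohomology space `H^{2,2}(G_-; G)`. -/
abbrev H22 : Type _ := Z2 G.neg ⧸ (B2 G.neg).submoduleOf (Z2 G.neg)

variable {G}

/-- The cohomology class of a Spencer cocycle. -/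
def spencerClass : Z2 G.neg →ₗ[ℝ] H22 G := ((B2 G.neg).submoduleOf (Z2 G.neg)).mkQ

/-- The adjoint action of an element of `G_0` on `G_-`. -/
def adNeg (A : G.grade 0) : G.neg.carrier →ₗ[ℝ] G.neg.carrier :=
  (G.bracket A).restrict fun x hx => G.bracket_mem_neg 0 le_rfl A x A.2 hx

@[simp]
theorem coe_adNeg (A : G.grade 0) (x : G.neg.carrier) : (adNeg A x : L) = G.bracket A x := rfl

/-- The action of `G_0` on cochains of homological degree `1`:
`(A · f)(x) = [A, f(x)] - f([A, x])`. -/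
def act1 (A : G.grade 0) (f : G.neg.carrier →ₗ[ℝ] L) : G.neg.carrier →ₗ[ℝ] L :=
  (G.bracket A) ∘ₗ f - f ∘ₗ adNeg A

/-- The action of `G_0` on cochains of homological degree `2`:
`(A · φ)(x, y) = [A, φ(x, y)] - φ([A, x], y) - φ(x, [A, y])`. -/
def act2 (A : G.grade 0) : Bil G.neg →ₗ[ℝ] Bil G.neg where
  toFun φ := (G.bracket A) ∘ₗ φ - φ ∘ₗ (adNeg A).rTensor _ - φ ∘ₗ (adNeg A).lTensor _
  map_add' φ ψ := by ext; simp; abel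
  map_smul' c φ := by ext; simp [smul_sub]

theorem act1_apply (A : G.grade 0) (f : G.neg.carrier →ₗ[ℝ] L) (x : G.neg.carrier) :
    act1 A f x = G.bracket A (f x) - f (adNeg A x) := rfl

theorem act2_apply (A : G.grade 0) (φ : Bil G.neg) (x y : G.neg.carrier) :
    act2 A φ (x ⊗ₜ y) =
      G.bracket A (φ (x ⊗ₜ y)) - φ (adNeg A x ⊗ₜ y) - φ (x ⊗ₜ adNeg A y) := rfl

theorem bracket_zero_bracket (A : G.grade 0) (x y : L) :
    G.bracket A (G.bracket x y) =
      G.bracket (G.bracket A x) y + G.bracket x (G.bracket A y) := by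
  have hA : (A : L) ∈ G.parity 0 := by simpa using G.grade_le_parity 0 A.2
  have hx : x ∈ G.parity 0 ⊔ G.parity 1 := by
    rw [G.parity_isCompl.sup_eq_top]; trivial
  obtain ⟨u, hu, v, hv, rfl⟩ := Submodule.mem_sup.1 hx
  have h1 := G.jacobi 0 0 A u y hA hu
  have h2 := G.jacobi 0 1 A v y hA hv
  simp only [superSign, map_add, LinearMap.add_apply] at h1 h2 ⊢
  rw [h1, h2]
  simp
  abel

theorem adNeg_bracket (A : G.grade 0) (x y : G.neg.carrier) :
    adNeg A (G.neg.bracket x y) =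
      G.neg.bracket (adNeg A x) y + G.neg.bracket x (adNeg A y) :=
  Subtype.ext (by simpa using bracket_zero_bracket A (x : L) y)

theorem bracket_zero_mem (A : G.grade 0) (k : ℤ) (x : L) (hx : x ∈ G.grade k) :
    G.bracket A x ∈ G.grade k := by
  simpa using G.bracket_grade 0 k A x A.2 hx

theorem act1_mem (A : G.grade 0) {f : G.neg.carrier →ₗ[ℝ] L} (hf : f ∈ C1 G.neg) :
    act1 A f ∈ C1 G.neg := fun k x hx =>
  sub_mem (bracket_zero_mem A _ _ (hf k x hx)) (hf k _ (bracket_zero_mem A k x hx))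

theorem act2_mem (A : G.grade 0) {φ : Bil G.neg} (hφ : φ ∈ C2 G.neg) : act2 A φ ∈ C2 G.neg := by
  intro k l x y hx hy
  have hAx : ((adNeg A x : G.neg.carrier) : L) ∈ G.grade k := bracket_zero_mem A k x hx
  have hAy : ((adNeg A y : G.neg.carrier) : L) ∈ G.grade l := bracket_zero_mem A l y hy
  refine ⟨sub_mem (sub_mem (bracket_zero_mem A _ _ (hφ k l x y hx hy).1)
    (hφ k l _ y hAx hy).1) (hφ k l x _ hx hAy).1, ?_⟩
  simp only [act2_apply, (hφ k l x y hx hy).2, (hφ k l _ y hAx hy).2,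
    (hφ k l x _ hx hAy).2, map_neg, map_smul]
  module

theorem act2_mem_Z2 (A : G.grade 0) {φ : Bil G.neg} (hφ : φ ∈ Z2 G.neg) :
    act2 A φ ∈ Z2 G.neg := by
  refine ⟨act2_mem A hφ.1, fun k l m x y z hx hy hz => ?_⟩
  have hAx : ((adNeg A x : G.neg.carrier) : L) ∈ G.grade k := bracket_zero_mem A k x hx
  have hAy : ((adNeg A y : G.neg.carrier) : L) ∈ G.grade l := bracket_zero_mem A l y hy
  have hAz : ((adNeg A z : G.neg.carrier) : L) ∈ G.grade m := bracket_zero_mem A m z hz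
  have key : d2 G.neg (act2 A φ) k l m x y z =
      G.bracket A (d2 G.neg φ k l m x y z) - d2 G.neg φ k l m (adNeg A x) y z
        - d2 G.neg φ k l m x (adNeg A y) z - d2 G.neg φ k l m x y (adNeg A z) := by
    simp only [d2, act2_apply, map_add, map_sub, map_smul, adNeg_bracket, bracket_zero_bracket,
      coe_adNeg, TensorProduct.add_tmul]
    module
  rw [key, hφ.2 k l m x y z hx hy hz, hφ.2 k l m _ y z hAx hy hz,
    hφ.2 k l m x _ z hx hAy hz, hφ.2 k l m x y _ hx hy hAz]
  simp

theorem act2_mem_B2 (A : G.grade 0) {φ : Bil G.neg} (hφ : φ ∈ B2 G.neg) :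
    act2 A φ ∈ B2 G.neg := by
  obtain ⟨hC, f, hf, h⟩ := hφ
  refine ⟨act2_mem A hC, act1 A f, act1_mem A hf, fun k l x y hx hy => ?_⟩
  have hAx : ((adNeg A x : G.neg.carrier) : L) ∈ G.grade k := bracket_zero_mem A k x hx
  have hAy : ((adNeg A y : G.neg.carrier) : L) ∈ G.grade l := bracket_zero_mem A l y hy
  rw [act2_apply, h k l x y hx hy, h k l _ y hAx hy, h k l x _ hx hAy]
  simp only [d1, act1_apply, map_add, map_sub, map_smul, adNeg_bracket, bracket_zero_bracket,
    coe_adNeg]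
  module

/-- The action of `G_0` on the Spencer cohomology: `A · [φ] = [A · φ]`. -/
def actH22 (A : G.grade 0) : H22 G →ₗ[ℝ] H22 G :=
  Submodule.mapQ _ _ ((act2 A).restrict fun _ hφ => act2_mem_Z2 A hφ)
    (fun _ hφ => act2_mem_B2 A hφ)

/-- The space `H^{2,2}(G_-; G)^{G_0}` of invariant classes. -/
def invariantsH22 (G : GradedLieSuperalgebra L) : Submodule ℝ (H22 G) :=
  ⨅ A : G.grade 0, LinearMap.ker (actH22 A)

end Spencer

end

/-! ### Spinor modules and flat model superalgebras -/

/-- A spinor module `S` of an inner product space `(V, η)`, i.e. a finite-dimensional real module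
`S` of the even Clifford algebra `Cl_0(V, η)`, with the convention `v · v = -η(v, v)`. Since
`Cl_0(V, η)` is semisimple, with irreducible modules `S_1` or `S_+` and `S_-` depending on the
signature, these are the modules `N S_1` or `N_+ S_+ ⊕ N_- S_-`. -/
structure SpinorModule (V S : Type*) [AddCommGroup V] [Module ℝ V] [FiniteDimensional ℝ V]
    [AddCommGroup S] [Module ℝ S] [FiniteDimensional ℝ S] where
  η : LinearMap.BilinForm ℝ V
  η_symm : η.IsSymm
  η_nondegenerate : η.Nondegenerate
  ρ : CliffordAlgebra.even (-(LinearMap.BilinMap.toQuadraticMap η)) →ₐ[ℝ] Module.End ℝ S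

section

variable {V S : Type*} [AddCommGroup V] [Module ℝ V] [FiniteDimensional ℝ V]
  [AddCommGroup S] [Module ℝ S] [FiniteDimensional ℝ S]

namespace SpinorModule

variable (P : SpinorModule V S)

/-- The quadratic form `-η` of the Clifford algebra. -/
abbrev Q : QuadraticForm ℝ V := -(LinearMap.BilinMap.toQuadraticMap P.η)

/-- The space `so(V, η)` of `η`-skew endomorphisms. -/
def so : Submodule ℝ (Module.End ℝ V) where
  carrier := {A | ∀ v w, P.η (A v) w + P.η v (A w) = 0}
  add_mem' := by
    intro A B hA hB v w
    simp only [LinearMap.add_apply, map_add]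
    linear_combination hA v w + hB v w
  zero_mem' v w := by simp
  smul_mem' := by
    intro c A hA v w
    simp only [LinearMap.smul_apply, map_smul, smul_eq_mul]
    linear_combination c * hA v w

theorem so_skew (A : P.so) (v w : V) :
    P.η ((A : Module.End ℝ V) v) w = -P.η v ((A : Module.End ℝ V) w) :=
  eq_neg_of_add_eq_zero_left (A.2 v w)

/-- The commutator bracket of `so(V, η)`. -/
def comm (A B : P.so) : P.so :=
  ⟨(A : Module.End ℝ V) * (B : Module.End ℝ V) - (B : Module.End ℝ V) * (A : Module.End ℝ V), by
    intro v w
    simp only [LinearMap.sub_apply, Module.End.mul_apply, map_sub, P.so_skew]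
    ring⟩

theorem coe_comm (A B : P.so) : (P.comm A B : Module.End ℝ V) =
    (A : Module.End ℝ V) * (B : Module.End ℝ V) - (B : Module.End ℝ V) * (A : Module.End ℝ V) :=
  rfl

@[simp]
theorem comm_zero (A : P.so) : P.comm A 0 = 0 := Subtype.ext (by simp [coe_comm])

@[simp]
theorem zero_comm (A : P.so) : P.comm 0 A = 0 := Subtype.ext (by simp [coe_comm])

theorem η_comm (v w : V) : P.η v w = P.η w v := by
  simpa using P.η_symm.eq v w

/-- The Clifford element `-¼ ∑_i (A e_i) · e^i`, for a basis `e_i` of `V` with `η`-dual basis `e^i`.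
It is `-½ ω_A` where `ω_A ∈ Λ² V` is the bivector with `ι_{v^♭} ω_A = -A v`, and its commutator
with `v ∈ V` in the Clifford algebra is `A v`. -/
noncomputable def spinElt : Module.End ℝ V →ₗ[ℝ] CliffordAlgebra.even P.Q :=
  (-(1 / 4 : ℝ)) • ∑ i, ((CliffordAlgebra.even.ι P.Q).bilin.flip
    (P.η.dualBasis P.η_nondegenerate (Module.finBasis ℝ V) i)).comp
      (LinearMap.applyₗ (Module.finBasis ℝ V i))

/-- The action `A · s = -½ ω_A · s` of `so(V)` on the spinor module. -/
noncomputable def spinAct : P.so →ₗ[ℝ] Module.End ℝ S :=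
  P.ρ.toLinearMap ∘ₗ P.spinElt ∘ₗ P.so.subtype

theorem coe_spinElt (A : Module.End ℝ V) :
    (P.spinElt A : CliffordAlgebra P.Q) = (-(1 / 4 : ℝ)) • ∑ i,
      CliffordAlgebra.ι P.Q (A (Module.finBasis ℝ V i)) *
        CliffordAlgebra.ι P.Q (P.η.dualBasis P.η_nondegenerate (Module.finBasis ℝ V) i) := by
  simp [spinElt, CliffordAlgebra.even.ι]

theorem sum_dual (v : V) : ∑ i, P.η v (Module.finBasis ℝ V i) •
    P.η.dualBasis P.η_nondegenerate (Module.finBasis ℝ V) i = v := by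
  conv_rhs => rw [← (P.η.dualBasis P.η_nondegenerate (Module.finBasis ℝ V)).sum_repr v]
  simp only [LinearMap.BilinForm.dualBasis_repr_apply]

theorem sum_basis (v : V) : ∑ i,
    P.η v (P.η.dualBasis P.η_nondegenerate (Module.finBasis ℝ V) i) • Module.finBasis ℝ V i
      = v := by
  have h := (Module.finBasis ℝ V).sum_repr v
  conv_rhs => rw [← h]
  refine Finset.sum_congr rfl fun i _ => ?_
  congr 1
  rw [← LinearMap.BilinForm.dualBasis_repr_apply P.η_nondegenerate,
    LinearMap.BilinForm.dualBasis_dualBasis P.η_nondegenerate P.η_symm]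

theorem ι_mul_ι_add (v w : V) : CliffordAlgebra.ι P.Q v * CliffordAlgebra.ι P.Q w =
    (-2 * P.η v w) • (1 : CliffordAlgebra P.Q)
      - CliffordAlgebra.ι P.Q w * CliffordAlgebra.ι P.Q v := by
  rw [CliffordAlgebra.ι_mul_ι_comm, Algebra.algebraMap_eq_smul_one]
  congr 2
  have := P.η_comm v w
  simp only [QuadraticMap.polar, neg_apply, LinearMap.BilinMap.toQuadraticMap_apply,
    map_add, LinearMap.add_apply]
  linarith

theorem spinElt_comm (A : P.so) (v : V) :
    (P.spinElt A : CliffordAlgebra P.Q) * CliffordAlgebra.ι P.Q v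
      - CliffordAlgebra.ι P.Q v * (P.spinElt A : CliffordAlgebra P.Q)
      = CliffordAlgebra.ι P.Q ((A : Module.End ℝ V) v) := by
  have h : ∀ x y : V, CliffordAlgebra.ι P.Q x * CliffordAlgebra.ι P.Q y * CliffordAlgebra.ι P.Q v
      - CliffordAlgebra.ι P.Q v * (CliffordAlgebra.ι P.Q x * CliffordAlgebra.ι P.Q y) =
      CliffordAlgebra.ι P.Q ((-2 * P.η v y) • x + (2 * P.η x v) • y) := by
    intro x y
    rw [mul_assoc, P.ι_mul_ι_add y v, ← mul_assoc (CliffordAlgebra.ι P.Q v), P.ι_mul_ι_add v x]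
    have h1 := P.η_comm v x
    have h2 := P.η_comm v y
    rw [mul_sub, sub_mul, ← mul_assoc, map_add, map_smul, map_smul, h1, h2]
    simp only [mul_smul_comm, smul_mul_assoc, mul_one, one_mul]
    module
  rw [coe_spinElt, smul_mul_assoc, mul_smul_comm, ← smul_sub, Finset.sum_mul, Finset.mul_sum,
    ← Finset.sum_sub_distrib]
  simp only [h]
  rw [← map_sum, ← map_smul]
  congr 1
  rw [Finset.sum_add_distrib]
  have h1 : ∑ i, (-2 * P.η v (P.η.dualBasis P.η_nondegenerate (Module.finBasis ℝ V) i)) •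
      (A : Module.End ℝ V) (Module.finBasis ℝ V i) = (-2 : ℝ) • (A : Module.End ℝ V) v := by
    conv_rhs => rw [← P.sum_basis v]
    simp only [map_sum, map_smul, Finset.smul_sum, smul_smul]
  have h2 : ∑ i, (2 * P.η ((A : Module.End ℝ V) (Module.finBasis ℝ V i)) v) •
      P.η.dualBasis P.η_nondegenerate (Module.finBasis ℝ V) i
        = (-2 : ℝ) • (A : Module.End ℝ V) v := by
    conv_rhs => rw [← P.sum_dual ((A : Module.End ℝ V) v)]
    simp only [Finset.smul_sum, smul_smul]
    refine Finset.sum_congr rfl fun i _ => ?_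
    congr 1
    rw [P.so_skew, P.η_comm (Module.finBasis ℝ V i)]
    ring
  rw [h1, h2]
  module

theorem sum_skew {W : Type*} [AddCommGroup W] [Module ℝ W] (A : P.so) (f : V →ₗ[ℝ] V →ₗ[ℝ] W) :
    ∑ i, f (Module.finBasis ℝ V i) ((A : Module.End ℝ V)
        (P.η.dualBasis P.η_nondegenerate (Module.finBasis ℝ V) i)) =
      -∑ i, f ((A : Module.End ℝ V) (Module.finBasis ℝ V i))
        (P.η.dualBasis P.η_nondegenerate (Module.finBasis ℝ V) i) := by
  have h1 : ∀ i, f (Module.finBasis ℝ V i) ((A : Module.End ℝ V)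
        (P.η.dualBasis P.η_nondegenerate (Module.finBasis ℝ V) i)) =
      ∑ j, P.η ((A : Module.End ℝ V)
        (P.η.dualBasis P.η_nondegenerate (Module.finBasis ℝ V) i)) (Module.finBasis ℝ V j) •
        f (Module.finBasis ℝ V i) (P.η.dualBasis P.η_nondegenerate (Module.finBasis ℝ V) j) := by
    intro i
    conv_lhs => rw [← P.sum_dual ((A : Module.End ℝ V)
        (P.η.dualBasis P.η_nondegenerate (Module.finBasis ℝ V) i))]
    simp only [map_sum, map_smul]
  have h2 : ∀ j, f ((A : Module.End ℝ V) (Module.finBasis ℝ V j))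
        (P.η.dualBasis P.η_nondegenerate (Module.finBasis ℝ V) j) =
      ∑ i, P.η ((A : Module.End ℝ V) (Module.finBasis ℝ V j))
        (P.η.dualBasis P.η_nondegenerate (Module.finBasis ℝ V) i) •
        f (Module.finBasis ℝ V i) (P.η.dualBasis P.η_nondegenerate (Module.finBasis ℝ V) j) := by
    intro j
    conv_lhs => rw [← P.sum_basis ((A : Module.End ℝ V) (Module.finBasis ℝ V j))]
    simp only [map_sum, map_smul, LinearMap.sum_apply, LinearMap.smul_apply]
  simp only [h1, h2]
  rw [Finset.sum_comm, ← Finset.sum_neg_distrib]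
  refine Finset.sum_congr rfl fun j _ => ?_
  rw [← Finset.sum_neg_distrib]
  refine Finset.sum_congr rfl fun i _ => ?_
  rw [← neg_smul]
  congr 1
  rw [P.so_skew, P.η_comm ((A : Module.End ℝ V) (Module.finBasis ℝ V j))]

theorem spinElt_lie (A B : P.so) : P.spinElt (P.comm A B) =
    P.spinElt A * P.spinElt B - P.spinElt B * P.spinElt A := by
  have hA : ∀ x y : V, (P.spinElt A : CliffordAlgebra P.Q) *
      (CliffordAlgebra.ι P.Q x * CliffordAlgebra.ι P.Q y)
      - (CliffordAlgebra.ι P.Q x * CliffordAlgebra.ι P.Q y) * P.spinElt A =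
      CliffordAlgebra.ι P.Q ((A : Module.End ℝ V) x) * CliffordAlgebra.ι P.Q y +
      CliffordAlgebra.ι P.Q x * CliffordAlgebra.ι P.Q ((A : Module.End ℝ V) y) := by
    intro x y
    rw [← P.spinElt_comm A x, ← P.spinElt_comm A y]
    noncomm_ring
  apply Subtype.ext
  have hB := P.coe_spinElt (B : Module.End ℝ V)
  push_cast
  conv_rhs => rw [hB]
  rw [mul_smul_comm, smul_mul_assoc, ← smul_sub, Finset.mul_sum, Finset.sum_mul,
    ← Finset.sum_sub_distrib]
  simp only [hA]
  rw [Finset.sum_add_distrib]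
  have h := P.sum_skew A ((LinearMap.mul ℝ (CliffordAlgebra P.Q)).compl₁₂
    (CliffordAlgebra.ι P.Q ∘ₗ (B : Module.End ℝ V)) (CliffordAlgebra.ι P.Q))
  simp only [LinearMap.compl₁₂_apply, LinearMap.mul_apply', LinearMap.comp_apply] at h
  rw [h, coe_spinElt, ← sub_eq_add_neg, ← Finset.sum_sub_distrib]
  congr 1
  refine Finset.sum_congr rfl fun i _ => ?_
  rw [← sub_mul, ← map_sub]
  rfl

theorem spinAct_lie (A B : P.so) (s : S) :
    P.spinAct (P.comm A B) s = P.spinAct A (P.spinAct B s) - P.spinAct B (P.spinAct A s) := by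
  have h : P.spinAct (P.comm A B) = P.spinAct A * P.spinAct B - P.spinAct B * P.spinAct A := by
    change P.ρ (P.spinElt (P.comm A B)) = P.ρ _ * P.ρ _ - P.ρ _ * P.ρ _
    rw [spinElt_lie, map_sub, map_mul, map_mul]
    rfl
  rw [h]
  rfl

end SpinorModule

/-- A spinor module with a squaring map: a symmetric `so(V)`-equivariant bilinear map
`κ : S × S → V`. -/
structure FlatModel (V S : Type*) [AddCommGroup V] [Module ℝ V] [FiniteDimensional ℝ V]
    [AddCommGroup S] [Module ℝ S] [FiniteDimensional ℝ S] extends SpinorModule V S where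
  κ : S →ₗ[ℝ] S →ₗ[ℝ] V
  κ_symm : ∀ s t, κ s t = κ t s
  κ_equivariant : ∀ (A : toSpinorModule.so) (s t : S),
    (A : Module.End ℝ V) (κ s t) =
      κ (toSpinorModule.spinAct A s) t + κ s (toSpinorModule.spinAct A t)

theorem zmod_two_cases (i : ZMod 2) : i = 0 ∨ i = 1 := by
  revert i; decide

namespace FlatModel

variable (P : FlatModel V S)

/-- The space `V ⊕ S ⊕ so(V)`. -/
abbrev Carrier : Type _ := V × S × P.so

/-- The bracket of the flat model superalgebra:
`[A, B] = AB - BA`, `[A, v] = A v`, `[A, s] = A · s`, `[s, t] = κ(s, t)`, `[v, w] = [v, s] = 0`. -/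
noncomputable def bracket : P.Carrier →ₗ[ℝ] P.Carrier →ₗ[ℝ] P.Carrier :=
  LinearMap.mk₂ ℝ (fun x y =>
      ((x.2.2 : Module.End ℝ V) y.1 - (y.2.2 : Module.End ℝ V) x.1 + P.κ x.2.1 y.2.1,
        P.spinAct x.2.2 y.2.1 - P.spinAct y.2.2 x.2.1, P.comm x.2.2 y.2.2))
    (fun x x' y => by
      refine Prod.ext ?_ (Prod.ext ?_ ?_)
      · simp; abel
      · simp; abel
      · exact Subtype.ext (by simp [SpinorModule.coe_comm, add_mul, mul_add]; abel))
    (fun c x y => by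
      refine Prod.ext ?_ (Prod.ext ?_ ?_)
      · simp [smul_sub]
      · simp [smul_sub]
      · exact Subtype.ext (by simp [SpinorModule.coe_comm, smul_sub]))
    (fun x y y' => by
      refine Prod.ext ?_ (Prod.ext ?_ ?_)
      · simp; abel
      · simp; abel
      · exact Subtype.ext (by simp [SpinorModule.coe_comm, add_mul, mul_add]; abel))
    (fun c x y => by
      refine Prod.ext ?_ (Prod.ext ?_ ?_)
      · simp [smul_sub]
      · simp [smul_sub]
      · exact Subtype.ext (by simp [SpinorModule.coe_comm, smul_sub]))

theorem bracket_apply (x y : P.Carrier) : P.bracket x y =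
    ((x.2.2 : Module.End ℝ V) y.1 - (y.2.2 : Module.End ℝ V) x.1 + P.κ x.2.1 y.2.1,
      P.spinAct x.2.2 y.2.1 - P.spinAct y.2.2 x.2.1, P.comm x.2.2 y.2.2) := rfl

/-- The grading: `V`, `S`, `so(V)` have degrees `-2`, `-1`, `0`. -/
def grade (k : ℤ) : Submodule ℝ P.Carrier where
  carrier := {x | (k ≠ -2 → x.1 = 0) ∧ (k ≠ -1 → x.2.1 = 0) ∧ (k ≠ 0 → x.2.2 = 0)}
  add_mem' hx hy := ⟨fun h => by simp [hx.1 h, hy.1 h], fun h => by simp [hx.2.1 h, hy.2.1 h],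
    fun h => by simp [hx.2.2 h, hy.2.2 h]⟩
  zero_mem' := by simp
  smul_mem' c x hx := ⟨fun h => by simp [hx.1 h], fun h => by simp [hx.2.1 h],
    fun h => by simp [hx.2.2 h]⟩

/-- The parity: `V ⊕ so(V)` is even and `S` is odd. -/
def parity (i : ZMod 2) : Submodule ℝ P.Carrier where
  carrier := {x | (i ≠ 0 → x.1 = 0) ∧ (i ≠ 1 → x.2.1 = 0) ∧ (i ≠ 0 → x.2.2 = 0)}
  add_mem' hx hy := ⟨fun h => by simp [hx.1 h, hy.1 h], fun h => by simp [hx.2.1 h, hy.2.1 h],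
    fun h => by simp [hx.2.2 h, hy.2.2 h]⟩
  zero_mem' := by simp
  smul_mem' c x hx := ⟨fun h => by simp [hx.1 h], fun h => by simp [hx.2.1 h],
    fun h => by simp [hx.2.2 h]⟩

theorem mem_grade (k : ℤ) (x : P.Carrier) : x ∈ P.grade k ↔
    (k ≠ -2 → x.1 = 0) ∧ (k ≠ -1 → x.2.1 = 0) ∧ (k ≠ 0 → x.2.2 = 0) := Iff.rfl

theorem mem_parity (i : ZMod 2) (x : P.Carrier) : x ∈ P.parity i ↔
    (i ≠ 0 → x.1 = 0) ∧ (i ≠ 1 → x.2.1 = 0) ∧ (i ≠ 0 → x.2.2 = 0) := Iff.rfl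

theorem mem_parity_zero (x : P.Carrier) : x ∈ P.parity 0 ↔ x.2.1 = 0 := by simp [mem_parity]

theorem mem_parity_one (x : P.Carrier) : x ∈ P.parity 1 ↔ x.1 = 0 ∧ x.2.2 = 0 := by
  simp [mem_parity]

theorem parity_isCompl : IsCompl (P.parity 0) (P.parity 1) := by
  constructor
  · rw [Submodule.disjoint_def]
    intro x h0 h1
    rw [mem_parity_zero] at h0
    rw [mem_parity_one] at h1
    exact Prod.ext h1.1 (Prod.ext h0 h1.2)
  · rw [codisjoint_iff, eq_top_iff]
    rintro ⟨v, s, A⟩ -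
    refine Submodule.mem_sup.2 ⟨(v, 0, A), ?_, (0, s, 0), ?_, by simp⟩
    · simp [mem_parity_zero]
    · simp [mem_parity_one]

theorem grade_isInternal : DirectSum.IsInternal P.grade := by
  apply DirectSum.isInternal_submodule_of_iSupIndep_of_iSup_eq_top
  · intro k
    rw [Submodule.disjoint_def]
    intro x hx hx'
    have h : (⨆ j, ⨆ (_ : j ≠ k), P.grade j) ≤
        ({ carrier := {x | (k = -2 → x.1 = 0) ∧ (k = -1 → x.2.1 = 0) ∧ (k = 0 → x.2.2 = 0)}
           add_mem' := fun hx hy => ⟨fun h => by simp [hx.1 h, hy.1 h],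
            fun h => by simp [hx.2.1 h, hy.2.1 h], fun h => by simp [hx.2.2 h, hy.2.2 h]⟩
           zero_mem' := by simp
           smul_mem' := fun c x hx => ⟨fun h => by simp [hx.1 h], fun h => by simp [hx.2.1 h],
            fun h => by simp [hx.2.2 h]⟩ } : Submodule ℝ P.Carrier) := by
      refine iSup₂_le fun j hj x hx => ⟨fun h => hx.1 ?_, fun h => hx.2.1 ?_, fun h => hx.2.2 ?_⟩
        <;> omega
    have hx'' := h hx'
    refine Prod.ext ?_ (Prod.ext ?_ ?_)
    · exact (em (k = -2)).elim hx''.1 hx.1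
    · exact (em (k = -1)).elim hx''.2.1 hx.2.1
    · exact (em (k = 0)).elim hx''.2.2 hx.2.2
  · rw [eq_top_iff]
    rintro ⟨v, s, A⟩ -
    have h : ((v, s, A) : P.Carrier) = (v, 0, 0) + (0, s, 0) + (0, 0, A) := by simp
    rw [h]
    refine add_mem (add_mem ?_ ?_) ?_
    · exact Submodule.mem_iSup_of_mem (-2) (by simp [mem_grade])
    · exact Submodule.mem_iSup_of_mem (-1) (by simp [mem_grade])
    · exact Submodule.mem_iSup_of_mem 0 (by simp [mem_grade])

/-- The flat model superalgebra `s = V ⊕ S ⊕ so(V)`. -/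
noncomputable def superalgebra : GradedLieSuperalgebra P.Carrier where
  parity := P.parity
  parity_isCompl := P.parity_isCompl
  bracket := P.bracket
  bracket_parity i j x y hx hy := by
    obtain ⟨v, s, A⟩ := x
    obtain ⟨w, t, B⟩ := y
    rcases zmod_two_cases i with rfl | rfl <;> rcases zmod_two_cases j with rfl | rfl <;>
      simp only [add_zero, zero_add, CharTwo.add_self_eq_zero, mem_parity_zero, mem_parity_one]
        at hx hy ⊢ <;>
      simp [bracket_apply, hx, hy]
  skew i j x y hx hy := by
    obtain ⟨v, s, A⟩ := x
    obtain ⟨w, t, B⟩ := y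
    have h := P.κ_symm s t
    have h' : P.comm B A = -P.comm A B := Subtype.ext (by simp [SpinorModule.coe_comm])
    rw [bracket_apply, bracket_apply]
    simp only [h', P.κ_symm t s]
    rcases zmod_two_cases i with rfl | rfl <;> rcases zmod_two_cases j with rfl | rfl <;>
      simp only [mem_parity_zero, mem_parity_one] at hx hy <;>
      simp [superSign, hx, hy]
  jacobi i j x y z hx hy := by
    obtain ⟨v, s, A⟩ := x
    obtain ⟨w, t, B⟩ := y
    obtain ⟨u, r, C⟩ := z
    have h : P.comm A (P.comm B C) = P.comm (P.comm A B) C + P.comm B (P.comm A C) :=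
      Subtype.ext (by simp only [SpinorModule.coe_comm, Submodule.coe_add]; noncomm_ring)
    rcases zmod_two_cases i with rfl | rfl <;> rcases zmod_two_cases j with rfl | rfl <;>
      simp only [mem_parity_zero, mem_parity_one] at hx hy <;>
      [(subst hx; subst hy); (subst hx; obtain ⟨rfl, rfl⟩ := hy);
        (obtain ⟨rfl, rfl⟩ := hx; subst hy);
        (obtain ⟨rfl, rfl⟩ := hx; obtain ⟨rfl, rfl⟩ := hy)] <;>
      refine Prod.ext ?_ (Prod.ext ?_ ?_) <;>
      simp [bracket_apply, superSign, SpinorModule.spinAct_lie, SpinorModule.coe_comm,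
        P.κ_equivariant, h] <;>
      first | abel1 | (rw [P.κ_symm t]; abel1)
  grade := P.grade
  grade_isInternal := P.grade_isInternal
  grade_le_parity k x hx := by
    rw [mem_grade] at hx
    rw [mem_parity]
    refine ⟨fun h => hx.1 ?_, fun h => hx.2.1 ?_, fun h => hx.2.2 ?_⟩
    · rintro rfl; exact h (by decide)
    · rintro rfl; exact h (by decide)
    · rintro rfl; exact h (by decide)
  bracket_grade k l x y hx hy := by
    obtain ⟨v, s, A⟩ := x
    obtain ⟨w, t, B⟩ := y
    simp only [mem_grade] at hx hy
    simp only [mem_grade, bracket_apply]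
    refine ⟨fun h => ?_, fun h => ?_, fun h => ?_⟩
    · have h1 : (A : Module.End ℝ V) w = 0 := by
        by_cases hk : k = 0
        · rw [hy.1 (by omega), map_zero]
        · rw [hx.2.2 hk]; simp
      have h2 : (B : Module.End ℝ V) v = 0 := by
        by_cases hl : l = 0
        · rw [hx.1 (by omega), map_zero]
        · rw [hy.2.2 hl]; simp
      have h3 : P.κ s t = 0 := by
        by_cases hk : k = -1
        · rw [hy.2.1 (by omega), map_zero]
        · rw [hx.2.1 hk]; simp
      rw [h1, h2, h3]; simp
    · have h1 : P.spinAct A t = 0 := by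
        by_cases hk : k = 0
        · rw [hy.2.1 (by omega), map_zero]
        · rw [hx.2.2 hk]; simp
      have h2 : P.spinAct B s = 0 := by
        by_cases hl : l = 0
        · rw [hx.2.1 (by omega), map_zero]
        · rw [hy.2.2 hl]; simp
      rw [h1, h2]; simp
    · by_cases hk : k = 0
      · rw [hy.2.2 (by omega), SpinorModule.comm_zero]
      · rw [hx.2.2 hk, SpinorModule.zero_comm]

/-- `η` is Lorentzian, the timelike vectors being those with `ε η(v, v) > 0`; the signature is
`(1, n-1)` for `ε > 0` and `(n-1, 1)` for `ε < 0`. -/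
def IsLorentzian (ε : ℝ) : Prop :=
  ∃ u : V, 0 < ε * P.η u u ∧ ∀ v : V, P.η u v = 0 → v ≠ 0 → ε * P.η v v < 0

/-- The squaring map is causal: `κ(s, s)` is timelike or null for all `s`. -/
def IsCausal (ε : ℝ) : Prop := ∀ s : S, 0 ≤ ε * P.η (P.κ s s) (P.κ s s)

end FlatModel

end

end SpencerDef

/-! ### Homogeneous components of a graded Lie superalgebra, and transport of brackets. -/

namespace SpencerDef

section

variable {L : Type*} [AddCommGroup L] [Module ℝ L]
variable {M : Type*} [AddCommGroup M] [Module ℝ M]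

/-! Transport the bracket of the deformation to `𝔞` along `Φ`, giving `β = [·,·] + ∑ μ_d`. Parity is
the degree mod 2 and `β` respects it, so on homogeneous elements the `μ_d` of odd degree vanish and
`β = [·,·] + μ` up to degree at least `4`. The degree-2 part of the Jacobi identity of `β` is
therefore linear in `μ` (`μ_two_jacobi`). It is the cocycle condition on any graded subalgebra, in
particular on `𝔞_-` and on `𝔞` itself. With first argument `A ∈ 𝔥` it reads `A · μ = ∂(μ(A, ·))` on
`𝔞_-`, so the Spencer class is invariant.

For the second statement write `μ' - μ = ∂f` on `𝔞_-` and extend `f` to a degree-2 endomorphism of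
`𝔞`. Then `f² = 0`, and replacing `Φ'` by `Φ' ∘ (1 - f)` subtracts `∂f` from `μ'`
(`pullback_shear_sub_mem`). Since `𝔞` lives in degrees `-2, -1, 0`, the two transported brackets now
agree as soon as one argument is odd, and on two even arguments they differ by an element of `𝔥`.
The Jacobi identity for two even elements and an odd one shows that this element kills `S'`. So
everything follows once `𝔥` acts faithfully on `S'` (`FaithfulOdd.pullback_ext`).

Faithfulness is a Clifford computation (`eq_zero_of_spinAct_eq_zero`). Suppose `A ∈ so(V)` kills `W
⊆ S` with `dim W > ½ dim S`. For each Clifford product `X = v·w` a dimension count gives a nonzero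
`s ∈ W` with `X s ∈ W`. Hence `[A, X] = Av·w + v·Aw` kills `s` and is not invertible. In Lorentzian
signature, if `A ≠ 0`, some `v, w` built from a timelike vector make this commutator invertible,
except when `V` is a plane in which `A` moves that vector. There `A` itself acts as an invertible
bivector. -/

theorem superSign_comm (i j : ZMod 2) : superSign i j = superSign j i := by
  simp only [superSign, and_comm]

theorem superSign_mul_self (i j : ZMod 2) : superSign i j * superSign i j = 1 := by
  unfold superSign; split_ifs <;> norm_num

namespace GradedLieSuperalgebra

variable (G : GradedLieSuperalgebra L)

/-- The projection onto the homogeneous component of degree `k`. -/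
noncomputable def proj (k : ℤ) : L →ₗ[ℝ] L :=
  (G.grade k).subtype ∘ₗ DirectSum.component ℝ ℤ (fun j => G.grade j) k ∘ₗ
    (LinearEquiv.ofBijective (DirectSum.coeLinearMap G.grade) G.grade_isInternal).symm

theorem proj_mem (k : ℤ) (x : L) : G.proj k x ∈ G.grade k := Subtype.coe_prop _

theorem decompose_of_mem {j : ℤ} {x : L} (hx : x ∈ G.grade j) :
    (LinearEquiv.ofBijective (DirectSum.coeLinearMap G.grade) G.grade_isInternal).symm x =
      DirectSum.lof ℝ ℤ (fun j => G.grade j) j ⟨x, hx⟩ := by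
  rw [LinearEquiv.symm_apply_eq]
  exact (DirectSum.coeLinearMap_lof G.grade j ⟨x, hx⟩).symm

theorem proj_of_mem {k : ℤ} {x : L} (hx : x ∈ G.grade k) : G.proj k x = x := by
  simp only [proj, LinearMap.comp_apply, LinearEquiv.coe_coe, G.decompose_of_mem hx]
  simp

theorem proj_of_mem_ne {j k : ℤ} (h : j ≠ k) {x : L} (hx : x ∈ G.grade j) : G.proj k x = 0 := by
  simp only [proj, LinearMap.comp_apply, LinearEquiv.coe_coe, G.decompose_of_mem hx]
  simp [DirectSum.component.of, h]

/-- To prove a property of all elements of `L` it suffices to treat homogeneous elements. -/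
theorem homogeneous_induction {p : L → Prop} (x : L) (mem : ∀ k, ∀ x ∈ G.grade k, p x)
    (zero : p 0) (add : ∀ x y, p x → p y → p (x + y)) : p x := by
  have hx : x ∈ ⨆ k, G.grade k := by
    rw [G.grade_isInternal.submodule_iSup_eq_top]; trivial
  exact Submodule.iSup_induction _ (motive := p) hx mem zero add

/-- The subspace `⨁_{j ≥ k} G_j`. -/
def ge (k : ℤ) : Submodule ℝ L := ⨆ j : ℤ, ⨆ _ : k ≤ j, G.grade j

theorem grade_le_ge {k j : ℤ} (h : k ≤ j) : G.grade j ≤ G.ge k :=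
  le_iSup₂_of_le j h le_rfl

theorem ge_antitone {k l : ℤ} (h : k ≤ l) : G.ge l ≤ G.ge k :=
  iSup₂_le fun _ hj => G.grade_le_ge (h.trans hj)

theorem proj_of_mem_ge {j k : ℤ} (h : j < k) {x : L} (hx : x ∈ G.ge k) : G.proj j x = 0 := by
  have : G.ge k ≤ LinearMap.ker (G.proj j) :=
    iSup₂_le fun i hi y hy => G.proj_of_mem_ne (by omega) hy
  exact this hx

/-- The sums of the even and of the odd degrees lie in the two parity subspaces and together span,
so complementarity of the parity subspaces forces equality. -/
theorem parity_le (i : ZMod 2) :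
    G.parity i ≤ ⨆ k : ℤ, ⨆ _ : (k : ZMod 2) = i, G.grade k := by
  have hle : ∀ i : ZMod 2, (⨆ k : ℤ, ⨆ _ : (k : ZMod 2) = i, G.grade k) ≤ G.parity i :=
    fun i => iSup₂_le fun k hk => hk ▸ G.grade_le_parity k
  have htop : (⨆ k : ℤ, ⨆ _ : (k : ZMod 2) = 0, G.grade k) ⊔
      (⨆ k : ℤ, ⨆ _ : (k : ZMod 2) = 1, G.grade k) = ⊤ := by
    rw [eq_top_iff, ← G.grade_isInternal.submodule_iSup_eq_top]
    refine iSup_le fun k => ?_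
    rcases zmod_two_cases (k : ZMod 2) with h | h
    · exact le_sup_of_le_left (le_iSup₂_of_le k h le_rfl)
    · exact le_sup_of_le_right (le_iSup₂_of_le k h le_rfl)
  intro x hx
  have hx' := (htop ▸ Submodule.mem_top : x ∈ _)
  obtain ⟨a, ha, b, hb, rfl⟩ := Submodule.mem_sup.1 hx'
  have hd := Submodule.disjoint_def.1 G.parity_isCompl.disjoint
  have ha' := hle 0 ha
  have hb' := hle 1 hb
  rcases zmod_two_cases i with rfl | rfl
  · have : b ∈ G.parity 0 := by simpa using sub_mem hx ha'
    rw [hd b this hb', add_zero]; exact ha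
  · have : a ∈ G.parity 1 := by simpa using sub_mem hx hb'
    rw [hd a ha' this, zero_add]; exact hb

theorem proj_of_mem_parity {i : ZMod 2} {k : ℤ} (h : (k : ZMod 2) ≠ i) {x : L}
    (hx : x ∈ G.parity i) : G.proj k x = 0 := by
  have : (⨆ k : ℤ, ⨆ _ : (k : ZMod 2) = i, G.grade k) ≤ LinearMap.ker (G.proj k) :=
    iSup₂_le fun j hj y hy => G.proj_of_mem_ne (by rintro rfl; exact h hj) hy
  exact this (G.parity_le i hx)

end GradedLieSuperalgebra

/-- The bracket of a Lie superalgebra, transported along a linear isomorphism. -/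
def LieSuperalgebra.pullback (F : LieSuperalgebra M) (e : L ≃ₗ[ℝ] M) : L →ₗ[ℝ] L →ₗ[ℝ] L :=
  (F.bracket.compl₁₂ (e : L →ₗ[ℝ] M) (e : L →ₗ[ℝ] M)).compr₂ (e.symm : M →ₗ[ℝ] L)

theorem LieSuperalgebra.pullback_apply (F : LieSuperalgebra M) (e : L ≃ₗ[ℝ] M) (x y : L) :
    F.pullback e x y = e.symm (F.bracket (e x) (e y)) := rfl

theorem LieSuperalgebra.pullback_skew (F : LieSuperalgebra M) (e : L ≃ₗ[ℝ] M) {i j : ZMod 2}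
    {x y : L} (hx : e x ∈ F.parity i) (hy : e y ∈ F.parity j) :
    F.pullback e y x = -(superSign i j • F.pullback e x y) := by
  simp only [pullback_apply, F.skew i j _ _ hx hy, map_neg, map_smul]

theorem LieSuperalgebra.pullback_jacobi (F : LieSuperalgebra M) (e : L ≃ₗ[ℝ] M) {i j : ZMod 2}
    {x y : L} (hx : e x ∈ F.parity i) (hy : e y ∈ F.parity j) (z : L) :
    F.pullback e x (F.pullback e y z) = F.pullback e (F.pullback e x y) z +
      superSign i j • F.pullback e y (F.pullback e x z) := by
  simp only [pullback_apply, LinearEquiv.apply_symm_apply, F.jacobi i j _ _ _ hx hy, map_add,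
    map_smul]

variable {G : GradedLieSuperalgebra L} {F : FilteredLieSuperalgebra M}
  {D : FilteredDeformation G F} (σ : DefiningSequence D)

/-! ### The degree-2 term of a defining sequence as a cocycle with invariant class. -/

namespace DefiningSequence

/-- The deformed bracket on the underlying space of the graded Lie superalgebra. -/
abbrev deformed : L →ₗ[ℝ] L →ₗ[ℝ] L := F.pullback σ.Φ

theorem map_parity (i : ZMod 2) : (G.parity i).map (σ.Φ : L →ₗ[ℝ] M) = F.parity i := by
  have hle : ∀ i : ZMod 2, (G.parity i).map (σ.Φ : L →ₗ[ℝ] M) ≤ F.parity i := by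
    intro i
    refine (Submodule.map_mono (G.parity_le i)).trans ?_
    rw [Submodule.map_le_iff_le_comap]
    exact iSup₂_le fun k hk x hx => hk ▸ σ.Φ_parity k ⟨x, hx⟩
  refine le_antisymm (hle i) fun y hy => ?_
  obtain ⟨x, rfl⟩ := σ.Φ.surjective y
  have hx : x ∈ G.parity 0 ⊔ G.parity 1 := by
    rw [G.parity_isCompl.sup_eq_top]; trivial
  obtain ⟨a, ha, b, hb, rfl⟩ := Submodule.mem_sup.1 hx
  have ha' := hle 0 (Submodule.mem_map_of_mem ha)
  have hb' := hle 1 (Submodule.mem_map_of_mem hb)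
  have hd := Submodule.disjoint_def.1 F.parity_isCompl.disjoint
  simp only [LinearEquiv.coe_coe] at ha' hb'
  rcases zmod_two_cases i with rfl | rfl
  · have h : σ.Φ b ∈ F.parity 0 := by simpa using sub_mem hy ha'
    have h0 : b = 0 := by simpa using hd _ h hb'
    rw [h0, add_zero]; exact Submodule.mem_map_of_mem ha
  · have h : σ.Φ a ∈ F.parity 1 := by simpa using sub_mem hy hb'
    have h0 : a = 0 := by simpa using hd _ ha' h
    rw [h0, zero_add]; exact Submodule.mem_map_of_mem hb

theorem Φ_mem_parity {i : ZMod 2} {x : L} : σ.Φ x ∈ F.parity i ↔ x ∈ G.parity i := by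
  rw [← σ.map_parity i]
  exact ⟨fun ⟨y, hy, h⟩ => σ.Φ.injective h ▸ hy, fun h => Submodule.mem_map_of_mem h⟩

theorem deformed_mem_parity {i j : ZMod 2} {x y : L} (hx : x ∈ G.parity i) (hy : y ∈ G.parity j) :
    σ.deformed x y ∈ G.parity (i + j) := by
  rw [← σ.Φ_mem_parity, LieSuperalgebra.pullback_apply, LinearEquiv.apply_symm_apply]
  exact F.bracket_parity i j _ _ (σ.Φ_mem_parity.2 hx) (σ.Φ_mem_parity.2 hy)

theorem map_filt (k : ℤ) : (G.ge k).map (σ.Φ : L →ₗ[ℝ] M) = F.filt k := by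
  apply le_antisymm
  · rw [Submodule.map_le_iff_le_comap]
    exact iSup₂_le fun j hj x hx => F.filt_antitone hj (σ.Φ_filt j ⟨x, hx⟩)
  · obtain ⟨K, hK⟩ := F.filt_eq_bot
    have key : ∀ (n : ℕ) (k : ℤ), K ≤ k + n → F.filt k ≤ (G.ge k).map (σ.Φ : L →ₗ[ℝ] M) := by
      intro n
      induction n with
      | zero =>
        intro k hk
        have := F.filt_antitone (show K ≤ k by simpa using hk)
        rw [hK] at this
        exact this.trans bot_le
      | succ n ih =>
        intro k hk x hx
        -- `y` is the leading symbol of `x`. Subtracting `Φ y` pushes `x` one step down the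
        -- filtration, which reaches zero after finitely many steps.
        set y := D.grIso k (F.toGr k ⟨x, hx⟩) with hy
        have h1 : F.toGr k ⟨σ.Φ y, σ.Φ_filt k y⟩ = F.toGr k ⟨x, hx⟩ := by
          apply (D.grIso k).injective
          exact σ.Φ_gr k y
        have h2 : x - σ.Φ y ∈ F.filt (k + 1) := by
          have := (Submodule.Quotient.eq _).1 h1.symm
          exact this
        obtain ⟨z, hz, hzx⟩ := ih (k + 1) (by push_cast at hk; omega) h2
        refine ⟨y + z, add_mem (G.grade_le_ge le_rfl y.2) (G.ge_antitone (by omega) hz), ?_⟩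
        rw [map_add, hzx]
        simp
    exact key (K - k).toNat k (by omega)

theorem deformed_mem_ge {k l : ℤ} {x y : L} (hx : x ∈ G.ge k) (hy : y ∈ G.ge l) :
    σ.deformed x y ∈ G.ge (k + l) := by
  have h : F.bracket (σ.Φ x) (σ.Φ y) ∈ F.filt (k + l) := F.bracket_filt k l _ _
    (σ.map_filt k ▸ Submodule.mem_map_of_mem hx) (σ.map_filt l ▸ Submodule.mem_map_of_mem hy)
  rw [← σ.map_filt] at h
  obtain ⟨z, hz, h⟩ := h
  rw [LieSuperalgebra.pullback_apply, ← h]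
  simpa using hz

/-- Recovers `μ d` as a homogeneous component of the deformed bracket, so that skewness, parity and
the Jacobi identity pass from the bracket to `μ d` by projection. -/
theorem proj_deformed {d : ℕ} (hd : 0 < d) {k l : ℤ} {x y : L} (hx : x ∈ G.grade k)
    (hy : y ∈ G.grade l) : G.proj (k + l + d) (σ.deformed x y) = σ.μ d x y := by
  obtain ⟨N, hN⟩ := σ.bracket_eq x y
  rw [LieSuperalgebra.pullback_apply, hN (max N d) (le_max_left _ _), map_add, map_sum,
    G.proj_of_mem_ne (by omega) (G.bracket_grade k l x y hx hy), zero_add,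
    Finset.sum_eq_single_of_mem d (Finset.mem_Icc.2 ⟨hd, le_max_right _ _⟩)]
  · exact G.proj_of_mem (σ.μ_degree d hd k l x y hx hy)
  · intro c hc hcd
    exact G.proj_of_mem_ne (by omega) (σ.μ_degree c (Finset.mem_Icc.1 hc).1 k l x y hx hy)

/-- A term of odd degree would reverse the parity of the bracket. -/
theorem μ_odd {d : ℕ} (hd : Odd d) {k l : ℤ} {x y : L} (hx : x ∈ G.grade k)
    (hy : y ∈ G.grade l) : σ.μ d x y = 0 := by
  rw [← σ.proj_deformed hd.pos hx hy]
  refine G.proj_of_mem_parity ?_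
    (σ.deformed_mem_parity (G.grade_le_parity k hx) (G.grade_le_parity l hy))
  obtain ⟨c, rfl⟩ := hd
  have h2 : (2 : ZMod 2) = 0 := rfl
  push_cast
  rw [h2, zero_mul, zero_add]
  simp

/-- The deformed bracket up to terms of degree at least `4`. -/
theorem deformed_sub_mem {k l : ℤ} {x y : L} (hx : x ∈ G.grade k) (hy : y ∈ G.grade l) :
    σ.deformed x y - (G.bracket x y + σ.μ 2 x y) ∈ G.ge (k + l + 4) := by
  obtain ⟨N, hN⟩ := σ.bracket_eq x y
  rw [LieSuperalgebra.pullback_apply, hN (N + 4) (by omega), add_sub_add_left_eq_sub]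
  have h2 : 2 ∈ Finset.Icc 1 (N + 4) := Finset.mem_Icc.2 ⟨by omega, by omega⟩
  rw [← Finset.add_sum_erase _ _ h2, add_sub_cancel_left]
  refine sum_mem fun d hd => ?_
  rw [Finset.mem_erase, Finset.mem_Icc] at hd
  by_cases hodd : Odd d
  · rw [σ.μ_odd hodd hx hy]; exact zero_mem _
  · have h3 : d ≠ 3 := by rintro rfl; exact hodd (by decide)
    have h1 : d ≠ 1 := by rintro rfl; exact hodd (by decide)
    exact G.grade_le_ge (by omega) (σ.μ_degree d (by omega) k l x y hx hy)

/-- Decomposition of the degree-`2` part of an iterated deformed bracket. -/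
theorem proj_deformed_deformed {k l m : ℤ} {x y z : L} (hx : x ∈ G.grade k) (hy : y ∈ G.grade l)
    (hz : z ∈ G.grade m) : G.proj (k + l + m + 2) (σ.deformed x (σ.deformed y z)) =
      G.bracket x (σ.μ 2 y z) + σ.μ 2 x (G.bracket y z) := by
  have hyz := G.bracket_grade l m y z hy hz
  have hμ := σ.μ_degree 2 (by norm_num) l m y z hy hz
  set R := σ.deformed y z - (G.bracket y z + σ.μ 2 y z) with hR
  have hRm : R ∈ G.ge (l + m + 4) := σ.deformed_sub_mem hy hz
  -- Only two contributions reach degree `2`: the undeformed outer bracket on `μ 2 y z` and the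
  -- degree-2 outer bracket on `[y, z]`. The remainder `R` already starts in relative degree `4`.
  have h : σ.deformed y z = G.bracket y z + σ.μ 2 y z + R := by rw [hR]; abel
  have h1 := σ.proj_deformed (d := 2) (by norm_num) hx hyz
  have h2 : G.proj (k + l + m + 2) (σ.deformed x (σ.μ 2 y z)) = G.bracket x (σ.μ 2 y z) := by
    have e : σ.deformed x (σ.μ 2 y z) = (σ.deformed x (σ.μ 2 y z) -
        (G.bracket x (σ.μ 2 y z) + σ.μ 2 x (σ.μ 2 y z))) + G.bracket x (σ.μ 2 y z)
          + σ.μ 2 x (σ.μ 2 y z) := by abel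
    have h4 := G.bracket_grade _ _ _ _ hx hμ
    rw [e, map_add, map_add, G.proj_of_mem_ge ?_ (σ.deformed_sub_mem hx hμ),
      G.proj_of_mem_ne ?_ (σ.μ_degree 2 (by norm_num) _ _ _ _ hx hμ), add_zero, zero_add]
    · rw [show k + l + m + 2 = k + (l + m + (2 : ℕ)) by push_cast; ring]
      exact G.proj_of_mem h4
    · push_cast; omega
    · push_cast; omega
  have h3 : G.proj (k + l + m + 2) (σ.deformed x R) = 0 :=
    G.proj_of_mem_ge (k := k + (l + m + 4)) (by omega)
      (σ.deformed_mem_ge (G.grade_le_ge le_rfl hx) hRm)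
  rw [h, map_add, map_add, map_add, map_add, h2, h3, add_zero, add_comm]
  congr 1
  rw [← h1, show k + l + m + 2 = k + (l + m) + (2 : ℕ) by push_cast; ring]

theorem μ_two_skew {k l : ℤ} {x y : L} (hx : x ∈ G.grade k) (hy : y ∈ G.grade l) :
    σ.μ 2 y x = -(superSign k l • σ.μ 2 x y) := by
  rw [← σ.proj_deformed (by norm_num) hx hy, ← σ.proj_deformed (by norm_num) hy hx,
    F.pullback_skew σ.Φ (σ.Φ_parity k ⟨x, hx⟩) (σ.Φ_parity l ⟨y, hy⟩), map_neg, map_smul,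
    add_comm k l]

theorem μ_two_jacobi {k l m : ℤ} {x y z : L} (hx : x ∈ G.grade k) (hy : y ∈ G.grade l)
    (hz : z ∈ G.grade m) :
    G.bracket x (σ.μ 2 y z) + σ.μ 2 x (G.bracket y z) =
      -(superSign (k + l) m • (G.bracket z (σ.μ 2 x y) + σ.μ 2 z (G.bracket x y))) +
      superSign k l • (G.bracket y (σ.μ 2 x z) + σ.μ 2 y (G.bracket x z)) := by
  have hJ := F.pullback_jacobi σ.Φ (σ.Φ_parity k ⟨x, hx⟩) (σ.Φ_parity l ⟨y, hy⟩) z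
  have hxy := σ.deformed_mem_parity (G.grade_le_parity k hx) (G.grade_le_parity l hy)
  -- The term `β(β(x, y), z)` is turned around, so that all three terms have the right-nested form
  -- treated by `proj_deformed_deformed`.
  have hS := F.pullback_skew σ.Φ (σ.Φ_parity m ⟨z, hz⟩) (σ.Φ_mem_parity.2 hxy)
  have := congrArg (G.proj (k + l + m + 2)) hJ
  dsimp only at this hS
  rw [hS, map_add, map_neg, map_smul, map_smul, σ.proj_deformed_deformed hx hy hz,
    show k + l + m + 2 = l + k + m + 2 by ring, σ.proj_deformed_deformed hy hx hz,
    show l + k + m + 2 = m + k + l + 2 by ring, σ.proj_deformed_deformed hz hx hy,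
    superSign_comm] at this
  exact this

theorem restrict_mem_Z2 (n : GradedSubalgebra G) : n.restrict (σ.μ 2) ∈ Z2 n := by
  refine ⟨fun k l x y hx hy => ?_, fun k l m x y z hx hy hz => ?_⟩
  · exact ⟨σ.μ_degree 2 (by norm_num) k l x y hx hy, σ.μ_two_skew hx hy⟩
  · have h := σ.μ_two_jacobi hx hy hz
    have e1 := σ.μ_two_skew (G.bracket_grade k l _ _ hx hy) hz
    have e2 := σ.μ_two_skew (G.bracket_grade l m _ _ hy hz) hx
    have e3 := σ.μ_two_skew (G.bracket_grade m k _ _ hz hx) hy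
    have e4 := σ.μ_two_skew hx hz
    have e5 := G.skew m k _ _ (G.grade_le_parity m hz) (G.grade_le_parity k hx)
    change (G.bracket x (σ.μ 2 y z) - σ.μ 2 (G.bracket x y) z)
      + superSign k (l + m) • (G.bracket y (σ.μ 2 z x) - σ.μ 2 (G.bracket y z) x)
      + superSign (k + l) m • (G.bracket z (σ.μ 2 x y) - σ.μ 2 (G.bracket z x) y) = 0
    rw [e4]
    rw [e5] at h
    simp only [Int.cast_add, superSign_comm _ (_ + _)] at h e1 e2 e3 e5 ⊢
    -- All signs depend only on the three parities. In each of the eight cases the cocycle condition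
    -- is the Jacobi relation `h` after reordering arguments.
    rcases zmod_two_cases (k : ZMod 2) with hk | hk <;>
    rcases zmod_two_cases (l : ZMod 2) with hl | hl <;>
    rcases zmod_two_cases (m : ZMod 2) with hm | hm <;>
    simp [superSign, hk, hl, hm] at h e1 e2 e3 ⊢ <;>
    rw [e1, e2, e3] at h <;>
    refine sub_eq_zero.1 (Eq.trans ?_ (sub_eq_zero.2 h)) <;>
    module

theorem spencerClass_mem_invariants :
    spencerClass ⟨G.neg.restrict (σ.μ 2), σ.restrict_mem_Z2 G.neg⟩ ∈ invariantsH22 G := by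
  rw [invariantsH22, Submodule.mem_iInf]
  intro A
  rw [LinearMap.mem_ker]
  refine (Submodule.Quotient.mk_eq_zero _).2 ?_
  -- The primitive of `A · μ` is the contraction `μ(A, ·)`, which has degree `2` because `A` has
  -- degree `0`.
  refine ⟨act2_mem A (σ.restrict_mem_Z2 G.neg).1, (σ.μ 2 A).domRestrict G.neg.carrier,
    fun k x hx => ?_, fun k l x y hx hy => ?_⟩
  · have := σ.μ_degree 2 (by norm_num) 0 k A x A.2 hx
    rwa [zero_add] at this
  · have h := σ.μ_two_jacobi A.2 hx hy
    have e := σ.μ_two_skew (bracket_zero_mem A k x hx) hy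
    change G.bracket A (σ.μ 2 x y) - σ.μ 2 (G.bracket A x) y - σ.μ 2 x (G.bracket A y) =
      G.bracket x (σ.μ 2 A y) - superSign k l • G.bracket y (σ.μ 2 A x)
        - σ.μ 2 A (G.bracket x y)
    have h0 : superSign ((0 : ℤ) : ZMod 2) k = 1 := by simp [superSign]
    rw [h0, e, Int.cast_zero, zero_add, smul_add, smul_neg, smul_smul, superSign_mul_self] at h
    refine sub_eq_zero.1 (Eq.trans ?_ (sub_eq_zero.2 h))
    module

end DefiningSequence
end
end SpencerDef

/-! ### Deformations with the same Spencer class, for algebras in degrees `-2, -1, 0`. -/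

namespace SpencerDef

section

variable {L : Type*} [AddCommGroup L] [Module ℝ L]
variable {M : Type*} [AddCommGroup M] [Module ℝ M]
variable {M' : Type*} [AddCommGroup M'] [Module ℝ M']

/-- The shear `1 - f` defined by an endomorphism of square zero. -/
def shear (f : L →ₗ[ℝ] L) (hf : ∀ x, f (f x) = 0) : L ≃ₗ[ℝ] L :=
  LinearEquiv.ofLinearMap (LinearMap.id - f) (LinearMap.id + f)
    (by ext x; simp [hf]) (by ext x; simp [hf])

theorem map_shear (f : L →ₗ[ℝ] L) (hf : ∀ x, f (f x) = 0) {p : Submodule ℝ L}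
    (hp : ∀ x ∈ p, f x ∈ p) : p.map (shear f hf : L →ₗ[ℝ] L) = p := by
  apply le_antisymm
  · rintro _ ⟨x, hx, rfl⟩
    exact sub_mem hx (hp x hx)
  · intro x hx
    exact ⟨x + f x, add_mem hx (hp x hx), (shear f hf).apply_symm_apply x⟩

theorem map_symm_trans {e : L ≃ₗ[ℝ] M} {e' : L ≃ₗ[ℝ] M'} {p : Submodule ℝ L}
    {q : Submodule ℝ M} {q' : Submodule ℝ M'} (h : p.map (e : L →ₗ[ℝ] M) = q)
    (h' : p.map (e' : L →ₗ[ℝ] M') = q') :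
    q.map (e.symm.trans e' : M →ₗ[ℝ] M') = q' := by
  subst h h'
  rw [← Submodule.map_comp]
  congr 1
  ext x
  simp

namespace GradedLieSuperalgebra

variable (G : GradedLieSuperalgebra L)

/-- The grading of `G` is concentrated in the degrees `-2`, `-1`, `0`. -/
def DepthTwo : Prop := ∀ k : ℤ, k ≠ -2 → k ≠ -1 → k ≠ 0 → G.grade k = ⊥

/-- The action of `G_0` on `G_{-1}` is faithful. -/
def FaithfulOdd : Prop :=
  ∀ A ∈ G.grade 0, (∀ s ∈ G.grade (-1), G.bracket A s = 0) → A = 0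

variable {G}

theorem mem_ge_of_degree {f : L →ₗ[ℝ] L} {d : ℤ}
    (hf : ∀ k, ∀ x ∈ G.grade k, f x ∈ G.grade (k + d)) {k : ℤ} {x : L} (hx : x ∈ G.ge k) :
    f x ∈ G.ge (k + d) := by
  have : G.ge k ≤ (G.ge (k + d)).comap f :=
    iSup₂_le fun j hj y hy => G.grade_le_ge (by omega) (hf j y hy)
  exact this hx

theorem mem_parity_of_degree_two {f : L →ₗ[ℝ] L}
    (hf : ∀ k, ∀ x ∈ G.grade k, f x ∈ G.grade (k + 2)) {i : ZMod 2} {x : L}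
    (hx : x ∈ G.parity i) : f x ∈ G.parity i := by
  have : (⨆ k : ℤ, ⨆ _ : (k : ZMod 2) = i, G.grade k) ≤ (G.parity i).comap f := by
    refine iSup₂_le fun j hj y hy => ?_
    have := G.grade_le_parity _ (hf j y hy)
    have h2 : (2 : ZMod 2) = 0 := rfl
    rwa [Int.cast_add, Int.cast_ofNat, h2, add_zero, hj] at this
  exact this (G.parity_le i hx)

namespace DepthTwo

theorem ge_eq_bot (hG : G.DepthTwo) {k : ℤ} (hk : 0 < k) : G.ge k = ⊥ :=
  (Submodule.eq_bot_iff _).2 fun x hx => by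
    have : G.ge k ≤ ⊥ :=
      iSup₂_le fun j hj => (hG j (by omega) (by omega) (by omega)).le
    exact this hx

theorem ge_zero_le (hG : G.DepthTwo) : G.ge 0 ≤ G.grade 0 := by
  refine iSup₂_le fun j hj => ?_
  rcases hj.eq_or_lt with rfl | h
  · exact le_rfl
  · rw [hG j (by omega) (by omega) (by omega)]; exact bot_le

theorem parity_one_le (hG : G.DepthTwo) : G.parity 1 ≤ G.grade (-1) := by
  refine (G.parity_le 1).trans (iSup₂_le fun j hj => ?_)
  by_cases h1 : j = -1
  · rw [h1]
  · by_cases h2 : j = -2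
    · subst h2; exact absurd hj (by decide)
    · by_cases h0 : j = 0
      · subst h0; exact absurd hj (by decide)
      · rw [hG j h2 h1 h0]; exact bot_le

theorem parity_zero_le (hG : G.DepthTwo) : G.parity 0 ≤ G.grade (-2) ⊔ G.grade 0 := by
  refine (G.parity_le 0).trans (iSup₂_le fun j hj => ?_)
  by_cases h2 : j = -2
  · rw [h2]; exact le_sup_left
  · by_cases h0 : j = 0
    · rw [h0]; exact le_sup_right
    · by_cases h1 : j = -1
      · subst h1; exact absurd hj (by decide)
      · rw [hG j h2 h1 h0]; exact bot_le

theorem grade_induction (hG : G.DepthTwo) {p : L → Prop} (x : L) (m2 : ∀ x ∈ G.grade (-2), p x)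
    (m1 : ∀ x ∈ G.grade (-1), p x) (m0 : ∀ x ∈ G.grade 0, p x)
    (add : ∀ x y, p x → p y → p (x + y)) : p x := by
  refine G.homogeneous_induction x (fun k y hy => ?_) (m0 0 (zero_mem _)) add
  by_cases h1 : k = -1
  · subst h1; exact m1 y hy
  · by_cases h2 : k = -2
    · subst h2; exact m2 y hy
    · by_cases h0 : k = 0
      · subst h0; exact m0 y hy
      · rw [hG k h2 h1 h0, Submodule.mem_bot] at hy
        rw [hy]; exact m0 0 (zero_mem _)

/-- `f ∘ f` raises degrees by `4`, whereas the degrees span an interval of length `2`. -/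
theorem sq_zero (hG : G.DepthTwo) {f : L →ₗ[ℝ] L} (hf : ∀ k, ∀ x ∈ G.grade k, f x ∈ G.grade (k + 2)) (x : L) :
    f (f x) = 0 := by
  refine G.homogeneous_induction (p := fun x => f (f x) = 0) x (fun k y hy => ?_) (by simp)
    (fun x y hx hy => by simp [hx, hy])
  by_cases hk : k < -2
  · rw [hG k (by omega) (by omega) (by omega), Submodule.mem_bot] at hy
    simp [hy]
  · have := hf _ _ (hf k y hy)
    rwa [hG _ (by omega) (by omega) (by omega), Submodule.mem_bot] at this

/-- Extension by zero of a Spencer cochain to an endomorphism of degree `2`. -/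
theorem exists_extension (hG : G.DepthTwo) {f : G.neg.carrier →ₗ[ℝ] L} (hf : f ∈ C1 G.neg) :
    ∃ g : L →ₗ[ℝ] L, (∀ k, ∀ x ∈ G.grade k, g x ∈ G.grade (k + 2)) ∧
      ∀ k, ∀ x : G.neg.carrier, (x : L) ∈ G.grade k → g x = f x := by
  have hmem : ∀ x, G.proj (-2) x ∈ G.neg.carrier := fun x =>
    (le_iSup₂_of_le (-2 : ℤ) (by norm_num) le_rfl :
      G.grade (-2) ≤ ⨆ k : ℤ, ⨆ _ : k < 0, G.grade k) (G.proj_mem (-2) x)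
  -- On `G_{-1}` a degree-2 map lands in `G_1 = 0`, so `f` is determined by its values on `G_{-2}`.
  refine ⟨f ∘ₗ (G.proj (-2)).codRestrict _ hmem, fun k x hx => ?_, fun k x hx => ?_⟩
  · by_cases hk : k = -2
    · subst hk; exact hf (-2) _ (G.proj_mem (-2) x)
    · have : (G.proj (-2)).codRestrict _ hmem x = 0 := Subtype.ext (G.proj_of_mem_ne hk hx)
      rw [LinearMap.comp_apply, this, map_zero]; exact zero_mem _
  · by_cases hk : k = -2
    · subst hk
      have : (G.proj (-2)).codRestrict _ hmem x = x := Subtype.ext (G.proj_of_mem hx)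
      rw [LinearMap.comp_apply, this]
    · have h0 : (G.proj (-2)).codRestrict _ hmem x = 0 := Subtype.ext (G.proj_of_mem_ne hk hx)
      rw [LinearMap.comp_apply, h0, map_zero]
      by_cases hk1 : k < -2
      · rw [hG k (by omega) (by omega) (by omega), Submodule.mem_bot] at hx
        rw [show x = 0 from Subtype.ext hx, map_zero]
      · have := hf k x hx
        rw [hG _ (by omega) (by omega) (by omega), Submodule.mem_bot] at this
        exact this.symm

end DepthTwo

/-- Two deformations of the bracket of `G` agree if they do so up to `G_0` and on odd elements. -/
theorem FaithfulOdd.pullback_ext (hG : G.DepthTwo) (hfaith : G.FaithfulOdd)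
    {F : LieSuperalgebra M} {F' : LieSuperalgebra M'} {e : L ≃ₗ[ℝ] M} {e' : L ≃ₗ[ℝ] M'}
    (he : ∀ i, (G.parity i).map (e : L →ₗ[ℝ] M) = F.parity i)
    (he' : ∀ i, (G.parity i).map (e' : L →ₗ[ℝ] M') = F'.parity i)
    (hlead : ∀ A ∈ G.grade 0, ∀ s ∈ G.grade (-1), F.pullback e A s = G.bracket A s)
    (hodd : ∀ x, ∀ s ∈ G.grade (-1), F.pullback e x s = F'.pullback e' x s)
    (heven : ∀ x ∈ G.parity 0, ∀ y ∈ G.parity 0,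
      F.pullback e x y - F'.pullback e' x y ∈ G.grade 0) :
    F.pullback e = F'.pullback e' := by
  have hm : ∀ i, ∀ x ∈ G.parity i, e x ∈ F.parity i := fun i x hx =>
    he i ▸ Submodule.mem_map_of_mem hx
  have hm' : ∀ i, ∀ x ∈ G.parity i, e' x ∈ F'.parity i := fun i x hx =>
    he' i ▸ Submodule.mem_map_of_mem hx
  -- An even and an odd argument give a bracket again in `G_{-1}`, so `hodd` also applies to the
  -- iterated brackets in the Jacobi identity.
  have hpar : ∀ x ∈ G.parity 0, ∀ s ∈ G.grade (-1), F.pullback e x s ∈ G.grade (-1) := by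
    intro x hx s hs
    have h := F.bracket_parity 0 1 _ _ (hm 0 x hx) (hm 1 s (G.grade_le_parity (-1) hs))
    rw [zero_add, ← he 1] at h
    obtain ⟨z, hz, h⟩ := h
    rw [LieSuperalgebra.pullback_apply, ← h]
    simpa using hG.parity_one_le hz
  have hee : ∀ x ∈ G.parity 0, ∀ y ∈ G.parity 0, F.pullback e x y = F'.pullback e' x y := by
    intro x hx y hy
    rw [← sub_eq_zero]
    -- The discrepancy lies in `G_0`, where by `hlead` the action on `s` is the deformed one. The
    -- Jacobi identity expresses the brackets of `β(x, y)` and `β'(x, y)` with `s` through brackets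
    -- having an odd second argument, and these agree.
    refine hfaith _ (heven x hx y hy) fun s hs => ?_
    rw [← hlead _ (heven x hx y hy) s hs, map_sub, LinearMap.sub_apply, sub_eq_zero]
    have h1 := F.pullback_jacobi e (hm 0 x hx) (hm 0 y hy) s
    have h2 := F'.pullback_jacobi e' (hm' 0 x hx) (hm' 0 y hy) s
    have hys := hpar y hy s hs
    have hxs := hpar x hx s hs
    rw [← hodd y s hs, ← hodd x s hs, ← hodd x _ hys, ← hodd y _ hxs, h1, add_left_inj] at h2
    rw [h2, hodd _ s hs]
  have hskew : ∀ s ∈ G.grade (-1), ∀ x, F.pullback e s x = F'.pullback e' s x := by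
    intro s hs x
    have hs' := G.grade_le_parity (-1) hs
    refine G.homogeneous_induction (p := fun x => F.pullback e s x = F'.pullback e' s x) x
      (fun k y hy => ?_) (by simp) fun x y hx hy => by rw [map_add, map_add, hx, hy]
    have hy' := G.grade_le_parity k hy
    rw [F.pullback_skew e (hm _ y hy') (hm _ s hs'),
      F'.pullback_skew e' (hm' _ y hy') (hm' _ s hs'), hodd y s hs]
  have h2 : G.grade (-2) ≤ G.parity 0 := G.grade_le_parity (-2)
  have h0 : G.grade 0 ≤ G.parity 0 := by simpa using G.grade_le_parity 0
  ext x y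
  refine hG.grade_induction (p := fun x => F.pullback e x y = F'.pullback e' x y) x
    (fun x hx => ?_) (fun x hx => hskew x hx y) (fun x hx => ?_)
    fun x x' hx hx' => by rw [map_add, map_add, LinearMap.add_apply, LinearMap.add_apply, hx, hx']
  · exact hG.grade_induction (p := fun y => F.pullback e x y = F'.pullback e' x y) y
      (fun y hy => hee x (h2 hx) y (h2 hy)) (fun y hy => hodd x y hy)
      (fun y hy => hee x (h2 hx) y (h0 hy)) fun y y' hy hy' => by rw [map_add, map_add, hy, hy']
  · exact hG.grade_induction (p := fun y => F.pullback e x y = F'.pullback e' x y) y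
      (fun y hy => hee x (h0 hx) y (h2 hy)) (fun y hy => hodd x y hy)
      (fun y hy => hee x (h0 hx) y (h0 hy)) fun y y' hy hy' => by rw [map_add, map_add, hy, hy']

end GradedLieSuperalgebra

variable {G : GradedLieSuperalgebra L} {F : FilteredLieSuperalgebra M}
  {D : FilteredDeformation G F} (σ : DefiningSequence D)

namespace DefiningSequence

theorem deformed_sub_bracket_mem {k l : ℤ} {x y : L} (hx : x ∈ G.grade k) (hy : y ∈ G.grade l) :
    σ.deformed x y - G.bracket x y ∈ G.ge (k + l + 2) := by
  have h := add_mem (G.ge_antitone (show k + l + 2 ≤ k + l + 4 by omega)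
    (σ.deformed_sub_mem hx hy)) (G.grade_le_ge le_rfl (σ.μ_degree 2 (by norm_num) k l x y hx hy))
  convert h using 1
  abel

/-- Precomposing `Φ` with `1 - f` turns the bracket `β` into `(1 + f) β((1 - f)x, (1 - f)y)`, whose
degree-2 term is `μ` minus the coboundary of `f`. -/
theorem pullback_shear_sub_mem {f : L →ₗ[ℝ] L}
    (hf : ∀ k, ∀ x ∈ G.grade k, f x ∈ G.grade (k + 2)) (hsq : ∀ x, f (f x) = 0)
    {k l : ℤ} {x y : L} (hx : x ∈ G.grade k) (hy : y ∈ G.grade l) :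
    F.pullback ((shear f hsq).trans σ.Φ) x y - (G.bracket x y + (σ.μ 2 x y -
      (G.bracket (f x) y + G.bracket x (f y) - f (G.bracket x y)))) ∈ G.ge (k + l + 4) := by
  have e : F.pullback ((shear f hsq).trans σ.Φ) x y =
      σ.deformed (x - f x) (y - f y) + f (σ.deformed (x - f x) (y - f y)) := rfl
  -- The expansion has eight terms. Each of `h1` to `h8` bounds one of them after removal of its
  -- part in relative degree `0` or `2`.
  have h1 := σ.deformed_sub_mem hx hy
  have h2 := σ.deformed_sub_bracket_mem (hf k x hx) hy
  have h3 := σ.deformed_sub_bracket_mem hx (hf l y hy)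
  have h4 := σ.deformed_mem_ge (G.grade_le_ge le_rfl (hf k x hx)) (G.grade_le_ge le_rfl (hf l y hy))
  have h5 := G.mem_ge_of_degree hf (σ.deformed_sub_bracket_mem hx hy)
  have h6 := G.mem_ge_of_degree hf (σ.deformed_mem_ge (G.grade_le_ge le_rfl (hf k x hx))
    (G.grade_le_ge le_rfl hy))
  have h7 := G.mem_ge_of_degree hf (σ.deformed_mem_ge (G.grade_le_ge le_rfl hx)
    (G.grade_le_ge le_rfl (hf l y hy)))
  have h8 := G.mem_ge_of_degree hf h4
  rw [show k + 2 + l + 2 = k + l + 4 by ring] at h2 h6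
  rw [show k + (l + 2) + 2 = k + l + 4 by ring] at h3 h7
  rw [show k + 2 + (l + 2) = k + l + 4 by ring] at h4
  rw [show k + l + 2 + 2 = k + l + 4 by ring] at h5
  replace h8 := G.ge_antitone (show k + l + 4 ≤ k + 2 + (l + 2) + 2 by omega) h8
  have := add_mem (sub_mem (sub_mem (add_mem (sub_mem (sub_mem h1 h2) h3) h4) h6) h7)
    (add_mem h5 h8)
  convert this using 1
  rw [e]
  simp only [map_sub, LinearMap.sub_apply]
  abel

end DefiningSequence

/-- Filtered deformations with defining sequences whose degree-`2` parts differ on `G_-` by the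
coboundary of `f` are isomorphic. -/
theorem nonempty_filteredIso_of_coboundary (hG : G.DepthTwo) (hfaith : G.FaithfulOdd)
    {F' : FilteredLieSuperalgebra M'} {D' : FilteredDeformation G F'} (σ' : DefiningSequence D')
    {f : L →ₗ[ℝ] L} (hf : ∀ k, ∀ x ∈ G.grade k, f x ∈ G.grade (k + 2))
    (hμ : ∀ k l : ℤ, k < 0 → l < 0 → ∀ x ∈ G.grade k, ∀ y ∈ G.grade l,
      σ'.μ 2 x y - σ.μ 2 x y = G.bracket (f x) y + G.bracket x (f y) - f (G.bracket x y)) :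
    Nonempty (FilteredIso F F') := by
  have hsq := hG.sq_zero hf
  set e' := (shear f hsq).trans σ'.Φ with he'
  have hmap : ∀ (p : Submodule ℝ L) (q : Submodule ℝ M'), (∀ x ∈ p, f x ∈ p) →
      p.map (σ'.Φ : L →ₗ[ℝ] M') = q → p.map (e' : L →ₗ[ℝ] M') = q := by
    intro p q hp h
    rw [he', LinearEquiv.coe_trans, Submodule.map_comp, map_shear f hsq hp, h]
  have hpar := fun i => hmap _ _ (fun x hx => G.mem_parity_of_degree_two hf hx) (σ'.map_parity i)
  -- On `G_-` the shear cancels the difference of the degree-2 terms, leaving relative degree `4`.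
  -- Without restriction on the degrees, only the undeformed brackets are known to cancel, leaving
  -- relative degree `2` in `hall`.
  have hneg : ∀ k l : ℤ, k < 0 → l < 0 → ∀ x ∈ G.grade k, ∀ y ∈ G.grade l,
      F.pullback σ.Φ x y - F'.pullback e' x y ∈ G.ge (k + l + 4) := by
    intro k l hk hl x hx y hy
    have h := sub_mem (σ.deformed_sub_mem hx hy) (σ'.pullback_shear_sub_mem hf hsq hx hy)
    rw [← hμ k l hk hl x hx y hy] at h
    convert h using 1
    abel
  have hall : ∀ k l : ℤ, ∀ x ∈ G.grade k, ∀ y ∈ G.grade l,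
      F.pullback σ.Φ x y - F'.pullback e' x y ∈ G.ge (k + l + 2) := by
    intro k l x hx y hy
    have h := sub_mem (σ.deformed_sub_mem hx hy) (σ'.pullback_shear_sub_mem hf hsq hx hy)
    have h1 := σ.μ_degree 2 (by norm_num) k l x y hx hy
    have h2 := σ'.μ_degree 2 (by norm_num) k l x y hx hy
    have h3 := G.bracket_grade _ _ _ _ (hf k x hx) hy
    have h4 := G.bracket_grade _ _ _ _ hx (hf l y hy)
    have h5 := hf _ _ (G.bracket_grade _ _ _ _ hx hy)
    rw [show k + 2 + l = k + l + 2 by ring] at h3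
    rw [← add_assoc] at h4
    have := add_mem (G.ge_antitone (show k + l + 2 ≤ k + l + 4 by omega) h)
      (G.grade_le_ge le_rfl (sub_mem h1 (sub_mem h2 (sub_mem (add_mem h3 h4) h5))))
    convert this using 1
    abel
  have key : F.pullback σ.Φ = F'.pullback e' := by
    refine hfaith.pullback_ext hG σ.map_parity hpar (fun A hA s hs => ?_) (fun x s hs => ?_)
      fun x hx y hy => ?_
    · have h := σ.deformed_sub_bracket_mem hA hs
      rwa [hG.ge_eq_bot (by norm_num), Submodule.mem_bot, sub_eq_zero] at h
    -- With `s` in degree `-1` the error starts in degree `1`, `2` or `1` according as `x` has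
    -- degree `-2`, `-1` or `0`, so it vanishes.
    · rw [← sub_eq_zero]
      refine hG.grade_induction (p := fun x => F.pullback σ.Φ x s - F'.pullback e' x s = 0) x
        (fun x hx => ?_) (fun x hx => ?_) (fun x hx => ?_) fun x y hx hy => ?_
      · have h := hneg (-2) (-1) (by norm_num) (by norm_num) x hx s hs
        rwa [hG.ge_eq_bot (by norm_num), Submodule.mem_bot] at h
      · have h := hneg (-1) (-1) (by norm_num) (by norm_num) x hx s hs
        rwa [hG.ge_eq_bot (by norm_num), Submodule.mem_bot] at h
      · have h := hall 0 (-1) x hx s hs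
        rwa [hG.ge_eq_bot (by norm_num), Submodule.mem_bot] at h
      · rw [map_add, map_add, LinearMap.add_apply, LinearMap.add_apply, add_sub_add_comm, hx, hy,
          add_zero]
    · obtain ⟨x2, hx2, x0, hx0, rfl⟩ := Submodule.mem_sup.1 (hG.parity_zero_le hx)
      obtain ⟨y2, hy2, y0, hy0, rfl⟩ := Submodule.mem_sup.1 (hG.parity_zero_le hy)
      -- The errors start in degree `0` for `(-2, -2)`, `(-2, 0)` and `(0, -2)`, and in degree `2`
      -- for `(0, 0)`. Thus all lie in `G_0`.
      have h22 := hneg (-2) (-2) (by norm_num) (by norm_num) x2 hx2 y2 hy2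
      have h20 := hall _ _ x2 hx2 y0 hy0
      have h02 := hall _ _ x0 hx0 y2 hy2
      have h00 := G.ge_antitone (show (0 : ℤ) ≤ 0 + 0 + 2 by norm_num) (hall _ _ x0 hx0 y0 hy0)
      have := hG.ge_zero_le (add_mem (add_mem h22 h20) (add_mem h02 h00))
      convert this using 1
      simp only [map_add, LinearMap.add_apply]
      abel
  refine ⟨⟨σ.Φ.symm.trans e', fun x y => ?_, fun i => map_symm_trans (σ.map_parity i) (hpar i),
    fun k => map_symm_trans (σ.map_filt k) (hmap _ _ (fun x hx => G.ge_antitone (by omega)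
      (G.mem_ge_of_degree hf hx)) (σ'.map_filt k))⟩⟩
  have h := congrArg e' (LinearMap.congr_fun₂ key (σ.Φ.symm x) (σ.Φ.symm y))
  simpa [LieSuperalgebra.pullback_apply] using h

theorem nonempty_filteredIso_of_spencerClass_eq (hG : G.DepthTwo) (hfaith : G.FaithfulOdd)
    {F' : FilteredLieSuperalgebra M'} {D' : FilteredDeformation G F'} (σ' : DefiningSequence D')
    (hμ : G.neg.restrict (σ.μ 2) ∈ Z2 G.neg) (hμ' : G.neg.restrict (σ'.μ 2) ∈ Z2 G.neg)
    (h : spencerClass ⟨G.neg.restrict (σ'.μ 2), hμ'⟩ =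
      spencerClass ⟨G.neg.restrict (σ.μ 2), hμ⟩) : Nonempty (FilteredIso F F') := by
  have hB : G.neg.restrict (σ'.μ 2) - G.neg.restrict (σ.μ 2) ∈ B2 G.neg :=
    (Submodule.Quotient.eq ((B2 G.neg).submoduleOf (Z2 G.neg))).1 h
  obtain ⟨-, f, hf, hd⟩ := hB
  obtain ⟨g, hg, hgf⟩ := hG.exists_extension hf
  refine nonempty_filteredIso_of_coboundary σ hG hfaith σ' hg fun k l hk hl x hx y hy => ?_
  have hmem : ∀ {k : ℤ}, k < 0 → ∀ {x}, x ∈ G.grade k → x ∈ G.neg.carrier := fun {k} hk {x} hx =>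
    (le_iSup₂_of_le k hk le_rfl : G.grade k ≤ ⨆ k : ℤ, ⨆ _ : k < 0, G.grade k) hx
  have hd' : σ'.μ 2 x y - σ.μ 2 x y = _ := hd k l ⟨x, hmem hk hx⟩ ⟨y, hmem hl hy⟩ hx hy
  rw [hd', d1, ← hgf k ⟨x, hmem hk hx⟩ hx, ← hgf l ⟨y, hmem hl hy⟩ hy, ← hgf (k + l) _ (G.bracket_grade k l x y hx hy)]
  have hgx := G.grade_le_parity _ (hg k x hx)
  have h2 : (2 : ZMod 2) = 0 := rfl
  rw [Int.cast_add, Int.cast_ofNat, h2, add_zero] at hgx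
  -- Since `g` is even, super skewness turns the signed term `[y, g x]` of the differential into `[g
  -- x, y]`.
  rw [G.skew k l _ _ hgx (G.grade_le_parity l hy), smul_neg, smul_smul, superSign_mul_self,
    one_smul]
  change _ = G.bracket (g x) y + G.bracket x (g y) - g (G.bracket x y)
  simp only [GradedSubalgebra.coe_bracket]
  abel

end
end SpencerDef

/-! ### Faithfulness of the spin action on large subspaces in Lorentzian signature. -/

namespace SpencerDef

section

variable {V S : Type*} [AddCommGroup V] [Module ℝ V] [FiniteDimensional ℝ V]
  [AddCommGroup S] [Module ℝ S] [FiniteDimensional ℝ S]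

/-- An endomorphism preserves some nonzero vector of a subspace of more than half the dimension,
up to that subspace. -/
theorem exists_ne_zero_mem_map_mem {W : Submodule ℝ S}
    (hW : Module.finrank ℝ S < 2 * Module.finrank ℝ W) (X : Module.End ℝ S) :
    ∃ s ∈ W, s ≠ 0 ∧ X s ∈ W := by
  have hlt : Module.finrank ℝ (S ⧸ W) < Module.finrank ℝ W := by
    have := W.finrank_quotient_add_finrank
    omega
  -- The composite `W → S → S ⧸ W` of inclusion, `X` and projection cannot be injective.
  have hk := LinearMap.ker_ne_bot_of_finrank_lt (f := W.mkQ ∘ₗ X ∘ₗ W.subtype) hlt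
  obtain ⟨s, hs, hs0⟩ := Submodule.exists_mem_ne_zero_of_ne_bot hk
  refine ⟨s, s.2, by simpa using hs0, ?_⟩
  simpa using hs

namespace SpinorModule

variable (P : SpinorModule V S)

/-- The Clifford product of two vectors, as an element of the even Clifford algebra. -/
noncomputable def evenMul (v w : V) : CliffordAlgebra.even P.Q :=
  (CliffordAlgebra.even.ι P.Q).bilin v w

theorem coe_evenMul (v w : V) : (P.evenMul v w : CliffordAlgebra P.Q) =
    CliffordAlgebra.ι P.Q v * CliffordAlgebra.ι P.Q w := rfl

theorem ι_mul_self (v : V) : CliffordAlgebra.ι P.Q v * CliffordAlgebra.ι P.Q v =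
    (-P.η v v) • (1 : CliffordAlgebra P.Q) := by
  rw [CliffordAlgebra.ι_sq_scalar, Algebra.algebraMap_eq_smul_one]
  rfl

theorem ι_mul_ι_anticomm {v w : V} (h : P.η v w = 0) :
    CliffordAlgebra.ι P.Q v * CliffordAlgebra.ι P.Q w =
      -(CliffordAlgebra.ι P.Q w * CliffordAlgebra.ι P.Q v) := by
  rw [P.ι_mul_ι_add, h, mul_zero, zero_smul, zero_sub]

/-- Orthogonal vectors anticommute. If both are non-null the scalar is nonzero, so their product
acts invertibly on spinors. -/
theorem evenMul_mul_self {v w : V} (h : P.η v w = 0) :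
    P.evenMul v w * P.evenMul v w = (-(P.η v v * P.η w w)) • 1 := by
  apply Subtype.ext
  push_cast
  rw [coe_evenMul]
  set x := CliffordAlgebra.ι P.Q v
  set y := CliffordAlgebra.ι P.Q w
  have hxy : y * x = -(x * y) := P.ι_mul_ι_anticomm (by rw [P.η_comm, h])
  calc x * y * (x * y) = x * (y * x) * y := by noncomm_ring
    _ = -((x * x) * (y * y)) := by rw [hxy]; noncomm_ring
    _ = _ := by
      rw [P.ι_mul_self, P.ι_mul_self, smul_mul_smul_comm, mul_one, ← neg_smul]
      congr 1; ring

/-- The commutator with `spinElt A` is a derivation of the Clifford algebra that restricts to `A` on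
vectors. -/
theorem commutator_evenMul (A : P.so) (v w : V) :
    P.spinElt A * P.evenMul v w - P.evenMul v w * P.spinElt A =
      P.evenMul ((A : Module.End ℝ V) v) w + P.evenMul v ((A : Module.End ℝ V) w) := by
  apply Subtype.ext
  push_cast
  simp only [coe_evenMul, ← P.spinElt_comm A]
  noncomm_ring

/-- An even Clifford element with a left inverse up to a scalar acts injectively on spinors. -/
theorem eq_zero_of_mul_eq_smul {z x : CliffordAlgebra.even P.Q} {c : ℝ} (hc : c ≠ 0)
    (h : z * x = c • 1) {s : S} (hs : P.ρ x s = 0) : s = 0 := by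
  have h1 : P.ρ (z * x) s = c • s := by rw [h, map_smul, map_one]; rfl
  rw [map_mul, Module.End.mul_apply, hs, map_zero] at h1
  exact (smul_eq_zero.1 h1.symm).resolve_left hc

/-- No commutator of the spin action of `A` is invertible, if `A` annihilates a subspace of more
than half the dimension. -/
theorem commutator_mul_ne_smul {A : P.so} {W : Submodule ℝ S}
    (hW : Module.finrank ℝ S < 2 * Module.finrank ℝ W) (hA : ∀ s ∈ W, P.spinAct A s = 0)
    (v w : V) {z : CliffordAlgebra.even P.Q} {c : ℝ}
    (h : z * (P.evenMul ((A : Module.End ℝ V) v) w + P.evenMul v ((A : Module.End ℝ V) w)) =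
      c • 1) : c = 0 := by
  by_contra hc
  -- Both `s` and `v·w·s` lie in `W`, so `A` kills both and the commutator of `A` with `v·w` kills
  -- `s`.
  obtain ⟨s, hs, hs0, hXs⟩ := exists_ne_zero_mem_map_mem hW (P.ρ (P.evenMul v w))
  refine hs0 (P.eq_zero_of_mul_eq_smul hc h ?_)
  rw [← commutator_evenMul, map_sub, map_mul, map_mul, LinearMap.sub_apply,
    Module.End.mul_apply, Module.End.mul_apply]
  have h1 : P.ρ (P.spinElt A) (P.ρ (P.evenMul v w) s) = 0 := hA _ hXs
  have h2 : P.ρ (P.spinElt A) s = 0 := hA _ hs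
  rw [h1, h2, map_zero, sub_zero]

/-- The product of two commuting bivectors. -/
theorem evenMul_sub_mul_add {a v u w : V} (hav : P.η a v = 0) (huw : P.η u w = 0)
    (hau : P.η a u = 0) (haw : P.η a w = 0) (hvu : P.η v u = 0) (hvw : P.η v w = 0) :
    (P.evenMul a v - P.evenMul u w) * (P.evenMul a v + P.evenMul u w) =
      (-(P.η a a * P.η v v) + P.η u u * P.η w w) • 1 := by
  have hcomm : P.evenMul a v * P.evenMul u w = P.evenMul u w * P.evenMul a v := by
    apply Subtype.ext
    push_cast
    simp only [coe_evenMul]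
    have h1 := P.ι_mul_ι_anticomm hau
    have h2 := P.ι_mul_ι_anticomm haw
    have h3 := P.ι_mul_ι_anticomm hvu
    have h4 := P.ι_mul_ι_anticomm hvw
    generalize CliffordAlgebra.ι P.Q a = a' at *
    generalize CliffordAlgebra.ι P.Q v = v' at *
    generalize CliffordAlgebra.ι P.Q u = u' at *
    generalize CliffordAlgebra.ι P.Q w = w' at *
    calc a' * v' * (u' * w') = a' * (v' * u') * w' := by noncomm_ring
      _ = -((a' * u') * (v' * w')) := by rw [h3]; noncomm_ring
      _ = -(u' * (a' * w') * v') := by rw [h1, h4]; noncomm_ring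
      _ = u' * w' * (a' * v') := by rw [h2]; noncomm_ring
  rw [mul_add, sub_mul, sub_mul, hcomm, P.evenMul_mul_self hav, P.evenMul_mul_self huw]
  module

/-- An element of `so(V)` acting on the span `V` of two orthogonal vectors `u`, `A u`. -/
theorem spinElt_eq_of_span {A : P.so} {u : V} (hu : P.η u u ≠ 0)
    (ha : P.η ((A : Module.End ℝ V) u) ((A : Module.End ℝ V) u) ≠ 0)
    (hspan : ∀ v, P.η u v = 0 → P.η ((A : Module.End ℝ V) u) v = 0 → v = 0) :
    P.spinElt A = (1 / (2 * P.η u u)) • P.evenMul u ((A : Module.End ℝ V) u) := by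
  set a := (A : Module.End ℝ V) u with hadef
  have hua : P.η u a = 0 := by
    have := P.so_skew A u u
    rw [P.η_comm (_ : V) u] at this
    linarith
  have hau : P.η a u = 0 := by rw [P.η_comm, hua]
  have hexp : ∀ v : V, v = (P.η v u / P.η u u) • u + (P.η v a / P.η a a) • a := by
    intro v
    rw [← sub_eq_zero]
    apply hspan
    · simp only [map_sub, map_add, map_smul, smul_eq_mul, hua, P.η_comm u v]
      field_simp; ring
    · simp only [map_sub, map_add, map_smul, smul_eq_mul, hau, P.η_comm a v]
      field_simp; ring
  have hAa : (A : Module.End ℝ V) a = (-(P.η a a / P.η u u)) • u := by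
    rw [hexp ((A : Module.End ℝ V) a)]
    have h1 : P.η ((A : Module.End ℝ V) a) u = -P.η a a := P.so_skew A a u
    have h2 : P.η ((A : Module.End ℝ V) a) a = 0 := by
      have := P.so_skew A a a
      rw [P.η_comm (_ : V) a] at this
      have h3 : P.η a ((A : Module.End ℝ V) a) = 0 := by linarith
      rw [P.η_comm, h3]
    rw [h1, h2]
    simp [neg_div]
  have hsum : ∀ w : V, ∑ i, P.η (P.η.dualBasis P.η_nondegenerate (Module.finBasis ℝ V) i) w •
      CliffordAlgebra.ι P.Q ((A : Module.End ℝ V) (Module.finBasis ℝ V i)) =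
        CliffordAlgebra.ι P.Q ((A : Module.End ℝ V) w) := by
    intro w
    conv_rhs => rw [← P.sum_basis w]
    simp only [map_sum, map_smul]
    exact Finset.sum_congr rfl fun i _ => by rw [P.η_comm]
  apply Subtype.ext
  rw [coe_spinElt]
  push_cast
  rw [coe_evenMul]
  -- Expanding the dual basis in `u, a` collapses the sum to `Au·u/η(u,u) + Aa·a/η(a,a)`. With `Au =
  -- a` and `Aa = -(η(a,a)/η(u,u)) u` this equals `-(2/η(u,u)) u·a`, and the factor `-1/4` yields
  -- the coefficient.
  have hterm : ∀ i, CliffordAlgebra.ι P.Q ((A : Module.End ℝ V) (Module.finBasis ℝ V i)) *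
      CliffordAlgebra.ι P.Q (P.η.dualBasis P.η_nondegenerate (Module.finBasis ℝ V) i) =
      (1 / P.η u u) • ((P.η (P.η.dualBasis P.η_nondegenerate (Module.finBasis ℝ V) i) u •
        CliffordAlgebra.ι P.Q ((A : Module.End ℝ V) (Module.finBasis ℝ V i))) *
          CliffordAlgebra.ι P.Q u) +
      (1 / P.η a a) • ((P.η (P.η.dualBasis P.η_nondegenerate (Module.finBasis ℝ V) i) a •
        CliffordAlgebra.ι P.Q ((A : Module.End ℝ V) (Module.finBasis ℝ V i))) *
          CliffordAlgebra.ι P.Q a) := by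
    intro i
    conv_lhs => rw [hexp (P.η.dualBasis P.η_nondegenerate (Module.finBasis ℝ V) i)]
    rw [map_add, map_smul, map_smul, mul_add, mul_smul_comm, mul_smul_comm, smul_mul_assoc,
      smul_mul_assoc, smul_smul, smul_smul]
    congr 2 <;> ring
  simp only [hterm]
  rw [Finset.sum_add_distrib, ← Finset.smul_sum, ← Finset.smul_sum, ← Finset.sum_mul,
    ← Finset.sum_mul, hsum, hsum, hAa, ← hadef, map_smul, P.ι_mul_ι_anticomm hau, smul_mul_assoc,
    smul_smul, smul_neg, ← neg_smul, ← add_smul, smul_smul]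
  congr 1
  field_simp
  ring

/-- In Lorentzian signature, an element of `so(V)` which annihilates a subspace of more than half
the dimension of a spinor module vanishes. -/
theorem eq_zero_of_spinAct_eq_zero {ε : ℝ} {u : V} (hu : 0 < ε * P.η u u)
    (hperp : ∀ v : V, P.η u v = 0 → v ≠ 0 → ε * P.η v v < 0) {A : P.so} {W : Submodule ℝ S}
    (hW : Module.finrank ℝ S < 2 * Module.finrank ℝ W) (hA : ∀ s ∈ W, P.spinAct A s = 0) :
    A = 0 := by
  by_contra hA0
  have hε : ε ≠ 0 := by rintro rfl; simp at hu
  have huu : P.η u u ≠ 0 := by intro h; simp [h] at hu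
  have hne : ∀ v : V, P.η u v = 0 → v ≠ 0 → P.η v v ≠ 0 := by
    intro v hv hv0 h
    have := hperp v hv hv0
    simp [h] at this
  have hskew : ∀ v : V, P.η v ((A : Module.End ℝ V) v) = 0 := by
    intro v
    have := P.so_skew A v v
    rw [P.η_comm (_ : V) v] at this
    linarith
  -- Every nonzero `v ⟂ u` is spacelike, so `u·v` squares to a nonzero scalar and cannot be a
  -- commutator of `A` with a product of two vectors.
  have hnot : ∀ v : V, P.η u v = 0 → v ≠ 0 → ∀ x y : V,
      P.evenMul ((A : Module.End ℝ V) x) y + P.evenMul x ((A : Module.End ℝ V) y) ≠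
        P.evenMul u v := by
    intro v hv hv0 x y hxy
    have h := P.commutator_mul_ne_smul hW hA x y (z := P.evenMul u v)
      (by rw [hxy]; exact P.evenMul_mul_self hv)
    exact mul_ne_zero huu (hne v hv hv0) (neg_eq_zero.1 h)
  have hzero : ∀ v : V, P.evenMul 0 v = 0 := fun v => by simp [evenMul]
  set a := (A : Module.End ℝ V) u with hadef
  have hua : P.η u a = 0 := hskew u
  have hau : P.η a u = 0 := by rw [P.η_comm, hua]
  -- If `A` fixes the timelike direction infinitesimally, the commutator with `u·v` is `u·Av`, with
  -- `Av ⟂ u`. So `Av = 0` for all `v`.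
  by_cases ha : a = 0
  · apply hA0
    apply Subtype.ext
    ext v
    by_contra hv
    refine hnot ((A : Module.End ℝ V) v) ?_ hv u v ?_
    · have := P.so_skew A u v
      rw [← hadef, ha] at this
      simpa using this
    · rw [← hadef, ha, hzero, zero_add]
  have haa := hne a hua ha
  -- `b` is the component of `Aa` orthogonal to `u`. The commutator of `A` with `u·a` is `a·a + u·Aa
  -- = u·b`, so `b ≠ 0` is impossible.
  set b := (A : Module.End ℝ V) a + (P.η a a / P.η u u) • u with hb
  have huAa : P.η u ((A : Module.End ℝ V) a) = -P.η a a := by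
    have := P.so_skew A u a
    rw [← hadef] at this
    linarith
  have hub : P.η u b = 0 := by
    rw [hb, map_add, map_smul, huAa, smul_eq_mul]
    field_simp; ring
  by_cases hb0 : b = 0
  · have hAa : (A : Module.End ℝ V) a = -(P.η a a / P.η u u) • u := by
      rw [hb] at hb0
      rw [eq_neg_of_add_eq_zero_left hb0, neg_smul]
    -- Now `A` preserves the plane of `u` and `a`. If this plane is all of `V`, the even Clifford
    -- algebra is commutative and commutators say nothing, but `A` acts as a nonzero multiple of the
    -- invertible `u·a`.
    by_cases hspan : ∀ v, P.η u v = 0 → P.η a v = 0 → v = 0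
    · have h := P.spinElt_eq_of_span huu haa hspan
      -- The zero endomorphism is a dummy: only a nonzero element of `W` is wanted.
      obtain ⟨s, hs, hs0, -⟩ := exists_ne_zero_mem_map_mem hW 0
      refine hs0 (P.eq_zero_of_mul_eq_smul (neg_ne_zero.2 (mul_ne_zero huu haa))
        (P.evenMul_mul_self hua) ?_)
      have h1 : P.ρ (P.spinElt A) s = 0 := hA s hs
      rw [h, map_smul, LinearMap.smul_apply] at h1
      exact (smul_eq_zero.1 h1).resolve_left (by positivity)
    · push Not at hspan
      obtain ⟨v, huv, hav, hv0⟩ := hspan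
      set w := (A : Module.End ℝ V) v with hw
      have huw : P.η u w = 0 := by
        have := P.so_skew A u v
        rw [← hadef, hav] at this
        linarith
      have haw : P.η a w = 0 := by
        have := P.so_skew A a v
        rw [hAa, map_smul, LinearMap.smul_apply, huv, smul_zero] at this
        linarith
      -- The commutator with `u·v` is `a·v + u·w`, a sum of commuting bivectors with inverse
      -- proportional to `a·v - u·w` unless the scalar vanishes. Up to the factor `ε²`, that scalar
      -- is strictly negative: `a, v` are spacelike, `u` is timelike, and `w` is spacelike or zero.
      have h := P.commutator_mul_ne_smul hW hA u v
        (P.evenMul_sub_mul_add hav huw hau haw (by rw [P.η_comm, huv]) (hskew v))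
      have h1 := mul_pos_of_neg_of_neg (hperp a hua ha) (hperp v huv hv0)
      have h2 : (ε * P.η u u) * (ε * P.η w w) ≤ 0 := by
        by_cases hw0 : w = 0
        · simp [hw0]
        · exact (mul_neg_of_pos_of_neg hu (hperp w huw hw0)).le
      have h3 : (ε * ε) * (-(P.η a a * P.η v v) + P.η u u * P.η w w) = 0 := by rw [h, mul_zero]
      nlinarith
  · refine hnot b hub hb0 u a ?_
    apply Subtype.ext
    push_cast
    simp only [coe_evenMul, ← hadef]
    rw [hb, map_add, map_smul, mul_add, mul_smul_comm, P.ι_mul_self, P.ι_mul_self, smul_smul,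
      add_comm]
    congr 2
    field_simp

end SpinorModule

end
end SpencerDef

/-! ### Graded subalgebras of the flat model: depth and faithfulness. -/

namespace SpencerDef

section

variable {V S : Type*} [AddCommGroup V] [Module ℝ V] [FiniteDimensional ℝ V]
  [AddCommGroup S] [Module ℝ S] [FiniteDimensional ℝ S]

namespace FlatModel

variable {P : FlatModel V S} (a : GradedSubalgebra P.superalgebra)

theorem depthTwo_toGraded : a.toGraded.DepthTwo := by
  intro k h2 h1 h0
  rw [Submodule.eq_bot_iff]
  intro x hx
  have hx' : (x : P.Carrier) ∈ P.grade k := hx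
  rw [mem_grade] at hx'
  exact Subtype.ext (Prod.ext (hx'.1 h2) (Prod.ext (hx'.2.1 h1) (hx'.2.2 h0)))

/-- The odd part `S'` of a graded subalgebra, as a subspace of `S`. -/
def oddPart : Submodule ℝ S :=
  a.carrier.comap (LinearMap.inr ℝ V (S × P.so) ∘ₗ LinearMap.inl ℝ S P.so)

theorem mem_oddPart {s : S} : s ∈ oddPart a ↔ ((0, s, 0) : P.Carrier) ∈ a.carrier := Iff.rfl

theorem finrank_parity_one_le :
    Module.finrank ℝ (a.toGraded.parity 1) ≤ Module.finrank ℝ (oddPart a) := by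
  have hpar : ∀ x : a.toGraded.parity 1, ((x : a.carrier) : P.Carrier).1 = 0 ∧
      ((x : a.carrier) : P.Carrier).2.2 = 0 := fun x => (P.mem_parity_one _).1 x.2
  let f : a.toGraded.parity 1 →ₗ[ℝ] oddPart a :=
    (LinearMap.fst ℝ S P.so ∘ₗ LinearMap.snd ℝ V (S × P.so) ∘ₗ a.carrier.subtype ∘ₗ
      (a.toGraded.parity 1).subtype).codRestrict _ fun x => by
        rw [mem_oddPart]
        have : ((0, ((x : a.carrier) : P.Carrier).2.1, 0) : P.Carrier) = (x : a.carrier) :=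
          Prod.ext (hpar x).1.symm (Prod.ext rfl (hpar x).2.symm)
        change ((0, ((x : a.carrier) : P.Carrier).2.1, 0) : P.Carrier) ∈ a.carrier
        rw [this]
        exact x.1.2
  refine LinearMap.finrank_le_finrank_of_injective (f := f) ?_
  intro x y hxy
  have h : ((x : a.carrier) : P.Carrier).2.1 = ((y : a.carrier) : P.Carrier).2.1 :=
    congrArg Subtype.val hxy
  exact Subtype.ext (Subtype.ext (Prod.ext ((hpar x).1.trans (hpar y).1.symm)
    (Prod.ext h ((hpar x).2.trans (hpar y).2.symm))))

/-- A degree-0 element acts on `S'` by the spin action of its `so(V)` component, so the Clifford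
argument applies with `W = S'`. -/
theorem faithfulOdd_toGraded {ε : ℝ} (hP : P.IsLorentzian ε)
    (hdim : Module.finrank ℝ S < 2 * Module.finrank ℝ (oddPart a)) :
    a.toGraded.FaithfulOdd := by
  obtain ⟨u, hu, hperp⟩ := hP
  intro A hA hAs
  have hA' : (A : P.Carrier) ∈ P.grade 0 := hA
  rw [mem_grade] at hA'
  refine Subtype.ext (Prod.ext (hA'.1 (by norm_num)) (Prod.ext (hA'.2.1 (by norm_num)) ?_))
  refine P.eq_zero_of_spinAct_eq_zero hu hperp hdim fun s hs => ?_
  have h := hAs ⟨(0, s, 0), hs⟩ (show ((0, s, 0) : P.Carrier) ∈ P.grade (-1) by simp [mem_grade])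
  have h' : P.bracket A (0, s, 0) = 0 := congrArg Subtype.val h
  rw [bracket_apply] at h'
  simpa using congrArg (fun x : P.Carrier => x.2.1) h'

end FlatModel

end
end SpencerDef

theorem proposition4p12
    {V S M M' : Type*} [AddCommGroup V] [Module ℝ V] [FiniteDimensional ℝ V]
    [AddCommGroup S] [Module ℝ S] [FiniteDimensional ℝ S]
    [AddCommGroup M] [Module ℝ M] [AddCommGroup M'] [Module ℝ M']
    (P : SpencerDef.FlatModel V S)
    (a : SpencerDef.GradedSubalgebra P.superalgebra)
    (F : SpencerDef.FilteredLieSuperalgebra M)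
    (D : SpencerDef.FilteredDeformation a.toGraded F)
    (σ : SpencerDef.DefiningSequence D) :
    ((∃ hμ : a.toGraded.neg.restrict (σ.μ 2) ∈ SpencerDef.Z2 a.toGraded.neg,
        SpencerDef.spencerClass ⟨a.toGraded.neg.restrict (σ.μ 2), hμ⟩ ∈
          SpencerDef.invariantsH22 a.toGraded) ∧
      a.toGraded.full.restrict (σ.μ 2) ∈ SpencerDef.Z2 a.toGraded.full) ∧
    (∀ ε : ℝ, P.IsLorentzian ε → P.IsCausal ε →
      Module.finrank ℝ S < 2 * Module.finrank ℝ (F.parity 1) →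
      ∀ (F' : SpencerDef.FilteredLieSuperalgebra M')
        (D' : SpencerDef.FilteredDeformation a.toGraded F')
        (σ' : SpencerDef.DefiningSequence D')
        (hμ : a.toGraded.neg.restrict (σ.μ 2) ∈ SpencerDef.Z2 a.toGraded.neg)
        (hμ' : a.toGraded.neg.restrict (σ'.μ 2) ∈ SpencerDef.Z2 a.toGraded.neg),
        SpencerDef.spencerClass ⟨a.toGraded.neg.restrict (σ'.μ 2), hμ'⟩ =
          SpencerDef.spencerClass ⟨a.toGraded.neg.restrict (σ.μ 2), hμ⟩ →
        Nonempty (SpencerDef.FilteredIso F F')) := by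
  refine ⟨⟨⟨σ.restrict_mem_Z2 _, σ.spencerClass_mem_invariants⟩, σ.restrict_mem_Z2 _⟩,
    fun ε hP _ hdim F' D' σ' hμ hμ' h => ?_⟩
  refine SpencerDef.nonempty_filteredIso_of_spencerClass_eq σ
    (SpencerDef.FlatModel.depthTwo_toGraded a)
    (SpencerDef.FlatModel.faithfulOdd_toGraded a hP (hdim.trans_le ?_)) σ' hμ hμ' h
  -- `Φ` carries the odd part of `𝔞` onto that of the deformation, so the bound on `dim F.parity 1`
  -- passes to `S'`.
  rw [← σ.map_parity 1]
  exact Nat.mul_le_mul_left 2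
    ((Submodule.finrank_map_le _ _).trans (SpencerDef.FlatModel.finrank_parity_one_le a))
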